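/- Let $n\ge 1$, let $\Omega\subset\mathbb R^n$ be open, and let $0<s<\infty$. For $f\in W^1_{1,\mathrm{loc}}(\Omega;\mathbb R^n)$ let $Df$ be its weak derivative, $|Df(x)|$ the operator norm of $Df(x)$ with respect to the Euclidean norm, and $J(x,f)=\det Df(x)$. The mapping $f$ has *finite distortion* if $J(x,f)\ge 0$ a.e. in $\Omega$ and $|Df(x)|^n\le K(x)\,J(x,f)$ a.e. in $\Omega$ for some function $K$ with $0<K<\infty$ a.e. in $\Omega$. Put $$K_{f,n}(x)=\frac{|Df(x)|}{|J(x,f)|^{1/n}}\in[0,\infty],$$ where, at points with $J(x,f)=0$, the value is $0$ if $Df(x)=0$ and $\infty$ if $Df(x)\ne 0$ (for a mapping with finite distortion the latter happens only on a null set). **Lemma.** Let $\varphi_k\in W^1_n(\Omega;\mathbb R^n)$, $k\in\mathbb N$, be mappings with finite distortion (in particular $J(x,\varphi_k)\ge 0$ a.e. in $\Omega$) that converge weakly in $W^1_n(\Omega;\mathbb R^n)$ to a mapping $\varphi_0$. Suppose that there is a function $M\in L_s(\Omega)$, $M\ge 0$ a.e. in $\Omega$, such that for every $k\in\mathbb N$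 $$K_{\varphi_k,n}(x)\le M(x)^{1/n}\quad\text{for almost all }x\in\Omega.$$ Then $\varphi_0$ has finite distortion (in particular $J(x,\varphi_0)\ge 0$ a.e. in $\Omega$), and $$K_{\varphi_0,n}(x)\le M(x)^{1/n}\qquad\text{and}\qquad |D\varphi_0(x)|^n\le M(x)\,J(x,\varphi_0)\qquad\text{for almost all }x\in\Omega.$$ -/

import Mathlib

open MeasureTheory Filter Topology
open scoped ENNReal ContDiff

noncomputable section

/-- Euclidean space `ℝⁿ`. -/
abbrev Rn (n : ℕ) : Type := EuclideanSpace ℝ (Fin n)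

/-- `D` is a weak (distributional) derivative of `f` on the open set `Ω`: both are locally
integrable on `Ω`, and `∫_Ω ∂_v θ • f = - ∫_Ω θ • D v` for every direction `v` and every test
function `θ ∈ C_0^∞(Ω)`. Only the values of `f` and `D` on `Ω` matter. -/
structure IsWeakDeriv {n : ℕ} (Ω : Set (Rn n)) (f : Rn n → Rn n)
    (D : Rn n → (Rn n →L[ℝ] Rn n)) : Prop where
  locInt : LocallyIntegrableOn f Ω volume
  locInt_deriv : LocallyIntegrableOn D Ω volume
  integral_eq : ∀ θ : Rn n → ℝ, ContDiff ℝ ∞ θ → HasCompactSupport θ → tsupport θ ⊆ Ω →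
    ∀ v : Rn n, ∫ x in Ω, (fderiv ℝ θ x v) • f x = - ∫ x in Ω, θ x • D x v

open Classical in
/-- The weak derivative `Df` of `f` on `Ω` (unique up to null sets; `0` if there is none). -/
def weakDeriv {n : ℕ} (Ω : Set (Rn n)) (f : Rn n → Rn n) : Rn n → (Rn n →L[ℝ] Rn n) :=
  if h : ∃ D, IsWeakDeriv Ω f D then h.choose else 0

theorem isWeakDeriv_weakDeriv {n : ℕ} {Ω : Set (Rn n)} {f : Rn n → Rn n}
    (h : ∃ D, IsWeakDeriv Ω f D) : IsWeakDeriv Ω f (weakDeriv Ω f) := by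
  unfold weakDeriv
  rw [dif_pos h]
  exact h.choose_spec

/-- The Jacobian determinant `J(x, f) = det Df(x)`. -/
def jacobian {n : ℕ} (Ω : Set (Rn n)) (f : Rn n → Rn n) (x : Rn n) : ℝ :=
  (weakDeriv Ω f x).det

/-- `f ∈ W^1_p(Ω)`. -/
structure MemW1 {n : ℕ} (p : ℝ≥0∞) (Ω : Set (Rn n)) (f : Rn n → Rn n) : Prop where
  memLp : MemLp f p (volume.restrict Ω)
  exists_weakDeriv : ∃ D, IsWeakDeriv Ω f D
  memLp_weakDeriv : MemLp (weakDeriv Ω f) p (volume.restrict Ω)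

/-- `f ∈ FD(Ω)`: a mapping with finite distortion. That is, `f ∈ W^1_{1,loc}(Ω)`, `J(x, f) ≥ 0`
a.e. in `Ω`, and `|Df(x)|^n ≤ K(x) J(x, f)` a.e. in `Ω` for some `K` with `0 < K < ∞` a.e. -/
structure FiniteDistortion {n : ℕ} (Ω : Set (Rn n)) (f : Rn n → Rn n) : Prop where
  memW1loc : ∃ D, IsWeakDeriv Ω f D
  jacobian_nonneg : ∀ᵐ x ∂volume.restrict Ω, 0 ≤ jacobian Ω f x
  exists_bound : ∃ K : Rn n → ℝ, ∀ᵐ x ∂volume.restrict Ω,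
    0 < K x ∧ ‖weakDeriv Ω f x‖ ^ n ≤ K x * jacobian Ω f x

/-- The distortion operator function `K_{f,p}(x) = |Df(x)| / |J(x, f)|^{1/p}`, with values in
`[0, ∞]`: at a zero of the Jacobian it is `0` if `Df(x) = 0`, and `∞` if `Df(x) ≠ 0`. -/
def distortionFn {n : ℕ} (p : ℝ) (Ω : Set (Rn n)) (f : Rn n → Rn n) (x : Rn n) : ℝ≥0∞ :=
  ENNReal.ofReal ‖weakDeriv Ω f x‖ / ENNReal.ofReal (|jacobian Ω f x| ^ (1 / p))

theorem IsWeakDeriv.congr {n : ℕ} {Ω : Set (Rn n)}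
    {f g : Rn n → Rn n} {D D' : Rn n → (Rn n →L[ℝ] Rn n)} (h : IsWeakDeriv Ω f D)
    (hf : f =ᵐ[volume.restrict Ω] g) (hD : D =ᵐ[volume.restrict Ω] D') :
    IsWeakDeriv Ω g D' := by
  have key : ∀ {F : Type} [NormedAddCommGroup F] {u v : Rn n → F},
      LocallyIntegrableOn u Ω volume → u =ᵐ[volume.restrict Ω] v →
      LocallyIntegrableOn v Ω volume := by
    intro F _ u v hu huv x hx
    obtain ⟨t, ht, hut⟩ := hu x hx
    refine ⟨t ∩ Ω, inter_mem ht self_mem_nhdsWithin, ?_⟩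
    have h1 : IntegrableOn u (t ∩ Ω) volume := hut.mono_set Set.inter_subset_left
    exact h1.congr_fun_ae (ae_restrict_of_ae_restrict_of_subset Set.inter_subset_right huv)
  refine ⟨key h.locInt hf, key h.locInt_deriv hD, fun θ h1 h2 h3 v => ?_⟩
  have e1 : ∫ x in Ω, (fderiv ℝ θ x v) • g x = ∫ x in Ω, (fderiv ℝ θ x v) • f x :=
    integral_congr_ae (hf.mono fun x hx => by simp only [hx])
  have e2 : ∫ x in Ω, θ x • D' x v = ∫ x in Ω, θ x • D x v :=
    integral_congr_ae (hD.mono fun x hx => by simp only [hx])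
  rw [e1, e2, h.integral_eq θ h1 h2 h3 v]

theorem integrableOn_smul_of_test {n : ℕ} {Ω : Set (Rn n)}
    {F : Type*} [NormedAddCommGroup F] [NormedSpace ℝ F]
    {θ : Rn n → ℝ} (hθ : Continuous θ) (hc : HasCompactSupport θ) (hs : tsupport θ ⊆ Ω)
    {u : Rn n → F} (hu : LocallyIntegrableOn u Ω volume) :
    Integrable (fun x => θ x • u x) (volume.restrict Ω) := by
  have h1 : IntegrableOn u (tsupport θ) volume := hu.integrableOn_compact_subset hs hc
  have h2 : IntegrableOn (fun x => θ x • u x) (tsupport θ) volume :=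
    h1.continuousOn_smul hθ.continuousOn hc
  have h3 : Integrable (fun x => θ x • u x) volume := by
    refine (integrableOn_iff_integrable_of_support_subset ?_).1 h2
    intro x hx
    apply subset_tsupport
    intro h0
    simp [h0] at hx
  exact h3.integrableOn

theorem locallyIntegrableOn_add {n : ℕ} {Ω : Set (Rn n)} {F : Type*} [NormedAddCommGroup F]
    {u v : Rn n → F} (hu : LocallyIntegrableOn u Ω volume)
    (hv : LocallyIntegrableOn v Ω volume) : LocallyIntegrableOn (u + v) Ω volume :=
  hu.add hv

theorem IsWeakDeriv.add {n : ℕ} {Ω : Set (Rn n)}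
    {f g : Rn n → Rn n} {D D' : Rn n → (Rn n →L[ℝ] Rn n)} (h : IsWeakDeriv Ω f D)
    (h' : IsWeakDeriv Ω g D') : IsWeakDeriv Ω (f + g) (D + D') := by
  refine ⟨locallyIntegrableOn_add h.locInt h'.locInt,
    locallyIntegrableOn_add h.locInt_deriv h'.locInt_deriv, fun θ h1 h2 h3 v => ?_⟩
  have c1 : Continuous (fun x => fderiv ℝ θ x v) :=
    (h1.continuous_fderiv (by simp)).clm_apply continuous_const
  have c2 : HasCompactSupport (fun x => fderiv ℝ θ x v) := h2.fderiv_apply ℝ v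
  have c3 : tsupport (fun x => fderiv ℝ θ x v) ⊆ Ω := (tsupport_fderiv_apply_subset ℝ v).trans h3
  have i1 := integrableOn_smul_of_test c1 c2 c3 h.locInt
  have i2 := integrableOn_smul_of_test c1 c2 c3 h'.locInt
  have i3 : Integrable (fun x => θ x • D x v) (volume.restrict Ω) :=
    (integrableOn_smul_of_test h1.continuous h2 h3 h.locInt_deriv).apply_continuousLinearMap v
  have i4 : Integrable (fun x => θ x • D' x v) (volume.restrict Ω) :=
    (integrableOn_smul_of_test h1.continuous h2 h3 h'.locInt_deriv).apply_continuousLinearMap v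
  simp only [Pi.add_apply, smul_add, add_apply]
  rw [integral_add i1 i2, integral_add i3 i4, h.integral_eq θ h1 h2 h3 v,
    h'.integral_eq θ h1 h2 h3 v, neg_add]

theorem IsWeakDeriv.smul {n : ℕ} {Ω : Set (Rn n)} (c : ℝ)
    {f : Rn n → Rn n} {D : Rn n → (Rn n →L[ℝ] Rn n)} (h : IsWeakDeriv Ω f D) :
    IsWeakDeriv Ω (c • f) (c • D) := by
  refine ⟨h.locInt.smul c, h.locInt_deriv.smul c, fun θ h1 h2 h3 v => ?_⟩
  simp only [Pi.smul_apply, smul_apply]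
  simp_rw [smul_comm _ c]
  rw [integral_smul, integral_smul, h.integral_eq θ h1 h2 h3 v, smul_neg]

theorem isWeakDeriv_zero {n : ℕ} (Ω : Set (Rn n)) :
    IsWeakDeriv Ω (0 : Rn n → Rn n) 0 := by
  have key : ∀ {F : Type} [NormedAddCommGroup F],
      LocallyIntegrableOn (0 : Rn n → F) Ω volume := fun {F} _ x _ =>
    ⟨Set.univ, univ_mem, (integrable_zero (Rn n) F volume).integrableOn⟩
  exact ⟨key, key, fun θ _ _ _ v => by simp⟩

/-- The Sobolev space `W^1_p(Ω)` of mappings into `ℝⁿ` as a normed space: the subspace of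
`L_p(Ω) × L_p(Ω)` formed by the pairs `(u, Du)`, with the induced norm
`max (‖u‖_p) (‖Du‖_p)`, which is equivalent to the other usual norms of `W^1_p(Ω)`. -/
def W1 {n : ℕ} (p : ℝ≥0∞) [Fact (1 ≤ p)] (Ω : TopologicalSpace.Opens (Rn n)) :
    Submodule ℝ (Lp (Rn n) p (volume.restrict (Ω : Set (Rn n))) ×
      Lp (Rn n →L[ℝ] Rn n) p (volume.restrict (Ω : Set (Rn n)))) where
  carrier := {u | IsWeakDeriv (Ω : Set (Rn n)) u.1 u.2}
  add_mem' := fun {a b} ha hb =>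
    (IsWeakDeriv.add ha hb).congr
      (Lp.coeFn_add a.1 b.1).symm (Lp.coeFn_add a.2 b.2).symm
  zero_mem' :=
    (isWeakDeriv_zero (Ω : Set (Rn n))).congr
      (Lp.coeFn_zero _ _ _).symm (Lp.coeFn_zero _ _ _).symm
  smul_mem' := fun c a ha =>
    (IsWeakDeriv.smul c ha).congr
      (Lp.coeFn_smul c a.1).symm (Lp.coeFn_smul c a.2).symm

/-- The element of the normed space `W^1_p(Ω)` represented by a mapping `f ∈ W^1_p(Ω)`. -/
def MemW1.toW1 {n : ℕ} {p : ℝ≥0∞} [Fact (1 ≤ p)] {Ω : TopologicalSpace.Opens (Rn n)}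
    {f : Rn n → Rn n} (hf : MemW1 p (Ω : Set (Rn n)) f) : W1 p Ω :=
  ⟨(hf.memLp.toLp f, hf.memLp_weakDeriv.toLp (weakDeriv (Ω : Set (Rn n)) f)),
    (isWeakDeriv_weakDeriv hf.exists_weakDeriv).congr
      hf.memLp.coeFn_toLp.symm hf.memLp_weakDeriv.coeFn_toLp.symm⟩

instance fact_one_le_natCast (n : ℕ) [NeZero n] : Fact (1 ≤ (n : ℝ≥0∞)) :=
  ⟨by exact_mod_cast Nat.one_le_iff_ne_zero.2 (NeZero.ne n)⟩

end

/-!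
The distortion inequality `|Dφ|^n ≤ M J(·, φ)` relates the derivative, which converges weakly, to
the Jacobian, a nonlinear function of it. Two facts let it pass to the limit.

*Weak continuity of the Jacobian.* If `φ_k ⇀ φ₀` weakly in `W^1_n`, then
`∫ θ J(·, φ_k) → ∫ θ J(·, φ₀)` for every test function `θ` (`tendsto_integral_mul_jacobian`). The
Jacobian is a null Lagrangian: `∫ det Dh = 0` for smooth compactly supported `h`
(`integral_detRows_fderiv_eq_zero`). Hence `∫ θ (det Du - det Dw)` is controlled by
`∫ |u - w| (|Du| + |Dw|)^(n - 1)`, in which no derivative falls on the difference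
(`abs_integral_mul_det_fderiv_sub_le`). Mollification at scale `ε` moves a mapping by at most
`ε ‖Du‖_n` in `L^n`, so that it changes `∫ θ det Du` by `O(ε)`, uniformly on bounded sets of `W^1_n`
(`IsWeakDeriv.abs_integral_mul_det_mollify_sub_le`). At a fixed scale, weak convergence makes the
mollified derivatives converge pointwise and boundedly, and dominated convergence applies
(`tendsto_integral_mul_det`). No compact embedding theorem is needed.

*Linearization.* On the measurable set `E = {M ≤ q}` one has `|Dφ_k|^n ≤ q J(·, φ_k)`. The tangent
line inequality `n a^(n-1) y ≤ y^n + (n - 1) a^n` turns this into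
`1_E n a^(n-1) A(Dφ_k) ≤ ‖A‖ (q J(·, φ_k) + (n - 1) a^n)` for every `a ≥ 0` and every linear
functional `A`; off `E` it holds since `J(·, φ_k) ≥ 0`. Both sides converge when tested with
`θ ≥ 0`: the left one by weak convergence, where the indicator of `E` does no harm, and the right one by weak
continuity of the Jacobian, where no indicator occurs, so that the equi-integrability of the
Jacobians is not an issue. The inequality thus holds almost everywhere for `φ₀`
(`ae_linearized_distortion_le_of_tendsto`), and `a = |Dφ₀(x)|` with a norming functional `A`
gives `|Dφ₀|^n ≤ q J(·, φ₀)` on `E`. Letting the rational `q` decrease to `M(x)` finishes the proof.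
-/

noncomputable section

/-! ### The Jacobian determinant as a multilinear function of the gradients -/

/-- The determinant of the matrix whose rows are the coordinates of `n` covectors of `ℝⁿ`,
as a continuous multilinear function of the covectors. -/
def detRows (n : ℕ) : ContinuousMultilinearMap ℝ (fun _ : Fin n => Rn n →L[ℝ] ℝ) ℝ where
  toMultilinearMap := Matrix.detRowAlternating.toMultilinearMap.compLinearMap fun _ =>
    { toFun := fun L j => L (EuclideanSpace.single j 1)
      map_add' := fun _ _ => rfl
      map_smul' := fun _ _ => rfl }
  cont := by
    refine Continuous.matrix_det (A := fun L : Fin n → (Rn n →L[ℝ] ℝ) =>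
      Matrix.of fun i j => L i (EuclideanSpace.single j 1)) ?_
    refine continuous_matrix fun i j => ?_
    exact (continuous_apply i).clm_apply continuous_const

theorem detRows_apply {n : ℕ} (L : Fin n → (Rn n →L[ℝ] ℝ)) :
    detRows n L = (Matrix.of fun i j => L i (EuclideanSpace.single j 1)).det := rfl

theorem det_eq_detRows {n : ℕ} (A : Rn n →L[ℝ] Rn n) :
    A.det = detRows n fun i => (EuclideanSpace.proj i).comp A := by
  rw [detRows_apply, ContinuousLinearMap.det,
    ← LinearMap.det_toMatrix (EuclideanSpace.basisFun (Fin n) ℝ).toBasis]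
  congr 1

/-! ### The Jacobian is a null Lagrangian -/

theorem HasCompactSupport.integrable_of_continuous {n : ℕ} {F : Type*} [NormedAddCommGroup F]
    {f : Rn n → F} (hc : HasCompactSupport f) (hf : Continuous f) : Integrable f :=
  hf.integrable_of_hasCompactSupport hc

/-- A function of permutations that is invariant under a transposition has signed sum zero. -/
theorem sum_sign_mul_eq_zero {ι : Type*} [Fintype ι] [DecidableEq ι] {a b : ι} (hab : a ≠ b)
    (F : Equiv.Perm ι → ℝ) (hF : ∀ σ, F (σ * Equiv.swap a b) = F σ) :
    ∑ σ : Equiv.Perm ι, (Equiv.Perm.sign σ : ℝ) * F σ = 0 := by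
  have h : ∑ σ : Equiv.Perm ι, (Equiv.Perm.sign σ : ℝ) * F σ =
      ∑ σ : Equiv.Perm ι, (Equiv.Perm.sign (σ * Equiv.swap a b) : ℝ) *
        F (σ * Equiv.swap a b) :=
    (Equiv.sum_comp (Equiv.mulRight (Equiv.swap a b))
      (fun σ => (Equiv.Perm.sign σ : ℝ) * F σ)).symm
  have h2 : ∑ σ : Equiv.Perm ι, (Equiv.Perm.sign (σ * Equiv.swap a b) : ℝ) *
        F (σ * Equiv.swap a b) = -∑ σ : Equiv.Perm ι, (Equiv.Perm.sign σ : ℝ) * F σ := by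
    rw [← Finset.sum_neg_distrib]
    refine Finset.sum_congr rfl fun σ _ => ?_
    rw [hF, Equiv.Perm.sign_mul, Equiv.Perm.sign_swap hab]
    simp
  linarith

theorem fderiv_fderiv_apply_comm {n : ℕ} {h : Rn n → ℝ} (hh : ContDiff ℝ ∞ h) (x v w : Rn n) :
    fderiv ℝ (fun y => fderiv ℝ h y v) x w = fderiv ℝ (fun y => fderiv ℝ h y w) x v := by
  have hd : DifferentiableAt ℝ (fderiv ℝ h) x :=
    ((hh.fderiv_right (m := ∞) (by simp)).differentiable (by simp)) x
  have hs : IsSymmSndFDerivAt ℝ h x := hh.contDiffAt.isSymmSndFDerivAt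
    (by simpa using WithTop.coe_le_coe.2 (le_top : (2 : ℕ∞) ≤ ⊤))
  have key : ∀ v w : Rn n, fderiv ℝ (fun y => fderiv ℝ h y v) x w
      = fderiv ℝ (fderiv ℝ h) x w v := fun v w => by
    rw [fderiv_clm_apply hd (differentiableAt_const v)]
    simp
  rw [key, key, hs]

/-- The integral of the Jacobian of a smooth compactly supported mapping vanishes. In the Leibniz
expansion, one integrates by parts in the first factor; the second derivatives that appear are
symmetric, and cancel in pairs of permutations of opposite sign. -/
theorem integral_detRows_fderiv_eq_zero {n : ℕ} [NeZero n] {h : Fin n → Rn n → ℝ}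
    (hh : ∀ i, ContDiff ℝ ∞ (h i)) (hc : ∀ i, HasCompactSupport (h i)) :
    ∫ x, detRows n (fun i => fderiv ℝ (h i) x) = 0 := by
  set e : Fin n → Rn n := fun j => EuclideanSpace.single j 1 with he
  -- the first derivatives `∂_a h_i`
  set d : Fin n → Fin n → Rn n → ℝ := fun i a x => fderiv ℝ (h i) x (e a) with hd
  have hds : ∀ i a, ContDiff ℝ ∞ (d i a) := fun i a =>
    ((hh i).fderiv_right (m := ∞) (by simp)).clm_apply contDiff_const
  have hdc : ∀ i a, HasCompactSupport (d i a) := fun i a => (hc i).fderiv_apply ℝ _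
  -- the product of all factors but the first one, and its partial derivatives
  set P : Equiv.Perm (Fin n) → Rn n → ℝ := fun σ x =>
    ∏ i ∈ Finset.univ.erase 0, d i (σ i) x with hP
  have hPs : ∀ σ, ContDiff ℝ ∞ (P σ) := fun σ => contDiff_prod fun i _ => hds _ _
  have hPd : ∀ σ x v, fderiv ℝ (P σ) x v = ∑ j ∈ Finset.univ.erase 0,
      (∏ i ∈ (Finset.univ.erase (0 : Fin n)).erase j, d i (σ i) x)
        * fderiv ℝ (d j (σ j)) x v := by
    intro σ x v
    have := HasFDerivAt.finsetProd (u := Finset.univ.erase (0 : Fin n))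
      (g := fun i => d i (σ i)) (g' := fun i => fderiv ℝ (d i (σ i)) x) (x := x)
      (fun i _ => ((hds i (σ i)).differentiable (by simp) x).hasFDerivAt)
    rw [hP, this.fderiv]
    simp
  have hterm : ∀ σ : Equiv.Perm (Fin n), ∫ x, ∏ i, d i (σ i) x =
      - ∫ x, h 0 x * fderiv ℝ (P σ) x (e (σ 0)) := by
    intro σ
    have h1 : ∀ x, ∏ i, d i (σ i) x = fderiv ℝ (h 0) x (e (σ 0)) * P σ x := fun x =>
      (Finset.mul_prod_erase Finset.univ (fun i => d i (σ i) x) (Finset.mem_univ 0)).symm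
    simp_rw [h1]
    have hPs' : Continuous fun x => fderiv ℝ (P σ) x (e (σ 0)) :=
      ((hPs σ).continuous_fderiv (by simp)).clm_apply continuous_const
    rw [integral_mul_fderiv_eq_neg_fderiv_mul_of_integrable, neg_neg]
    · exact ((hdc 0 (σ 0)).mul_right).integrable_of_continuous
        ((hds 0 (σ 0)).continuous.mul (hPs σ).continuous)
    · exact ((hc 0).mul_right).integrable_of_continuous ((hh 0).continuous.mul hPs')
    · exact ((hc 0).mul_right).integrable_of_continuous
        ((hh 0).continuous.mul (hPs σ).continuous)
    · exact fun x _ => (hh 0).differentiable (by simp) x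
    · exact fun x _ => (hPs σ).differentiable (by simp) x
  have hint : ∀ σ : Equiv.Perm (Fin n), Integrable fun x => ∏ i, d i (σ i) x := by
    intro σ
    have h1 : (fun x => ∏ i, d i (σ i) x) = fun x => d 0 (σ 0) x * P σ x := funext fun x =>
      (Finset.mul_prod_erase Finset.univ (fun i => d i (σ i) x) (Finset.mem_univ 0)).symm
    rw [h1]
    exact ((hdc 0 (σ 0)).mul_right).integrable_of_continuous
      ((hds 0 (σ 0)).continuous.mul (hPs σ).continuous)
  have hint2 : ∀ σ : Equiv.Perm (Fin n),
      Integrable fun x => h 0 x * fderiv ℝ (P σ) x (e (σ 0)) := fun σ =>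
    ((hc 0).mul_right).integrable_of_continuous ((hh 0).continuous.mul
      (((hPs σ).continuous_fderiv (by simp)).clm_apply continuous_const))
  have hdet : ∀ x, detRows n (fun i => fderiv ℝ (h i) x) =
      ∑ σ : Equiv.Perm (Fin n), (Equiv.Perm.sign σ : ℝ) * ∏ i, d i (σ i) x := by
    intro x
    rw [detRows_apply, ← Matrix.det_transpose, Matrix.det_apply']
    rfl
  simp_rw [hdet]
  rw [integral_finsetSum _ fun σ _ => (hint σ).const_mul _]
  simp_rw [integral_const_mul, hterm, mul_neg, Finset.sum_neg_distrib, ← integral_const_mul]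
  rw [← integral_finsetSum _ fun σ _ => (hint2 σ).const_mul _, neg_eq_zero]
  refine integral_eq_zero_of_ae (Eventually.of_forall fun x => ?_)
  simp only [Pi.zero_apply, hPd]
  simp_rw [Finset.mul_sum]
  rw [Finset.sum_comm]
  refine Finset.sum_eq_zero fun j hj => ?_
  have hj0 : (0 : Fin n) ≠ j := fun h0 => by simp [h0] at hj
  refine sum_sign_mul_eq_zero hj0 _ fun σ => ?_
  congr 2
  · refine Finset.prod_congr rfl fun i hi => ?_
    simp only [Finset.mem_erase, Finset.mem_univ, and_true] at hi
    rw [Equiv.Perm.mul_apply, Equiv.swap_apply_of_ne_of_ne hi.2 hi.1]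
  · simp only [Equiv.Perm.mul_apply, Equiv.swap_apply_left, Equiv.swap_apply_right]
    exact fderiv_fderiv_apply_comm (hh j) x _ _

/-! ### Integral estimates for differences of Jacobians -/

/-- Integration by parts: a test function and the `j`-th component of the mapping may be exchanged
in the Jacobian. -/
theorem integral_mul_detRows_fderiv {n : ℕ} [NeZero n] {h : Fin n → Rn n → ℝ} {θ : Rn n → ℝ}
    (hh : ∀ i, ContDiff ℝ ∞ (h i)) (hc : ∀ i, HasCompactSupport (h i))
    (hθ : ContDiff ℝ ∞ θ) (hθc : HasCompactSupport θ) (j : Fin n) :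
    ∫ x, θ x * detRows n (fun i => fderiv ℝ (h i) x) =
      - ∫ x, h j x * detRows n (Function.update (fun i => fderiv ℝ (h i) x) j (fderiv ℝ θ x)) := by
  have hfd : ∀ i, Continuous (fderiv ℝ (h i)) := fun i => (hh i).continuous_fderiv (by simp)
  have hcont : Continuous fun x => detRows n (fun i => fderiv ℝ (h i) x) :=
    (detRows n).cont.comp (continuous_pi hfd)
  have hcont2 : Continuous fun x =>
      detRows n (Function.update (fun i => fderiv ℝ (h i) x) j (fderiv ℝ θ x)) :=
    (detRows n).cont.comp ((continuous_pi hfd).update j (hθ.continuous_fderiv (by simp)))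
  have key := integral_detRows_fderiv_eq_zero (h := Function.update h j (fun x => θ x * h j x))
    (fun i => by
      rcases eq_or_ne i j with rfl | hij
      · simpa using hθ.mul (hh i)
      · simpa [hij] using hh i)
    (fun i => by
      rcases eq_or_ne i j with rfl | hij
      · simp only [Function.update_self]
        exact hθc.mul_right
      · simpa [hij] using hc i)
  have hpt : ∀ x, detRows n (fun i => fderiv ℝ (Function.update h j (fun x => θ x * h j x) i) x) =
      θ x * detRows n (fun i => fderiv ℝ (h i) x) +
      h j x * detRows n (Function.update (fun i => fderiv ℝ (h i) x) j (fderiv ℝ θ x)) := by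
    intro x
    have h1 : (fun i => fderiv ℝ (Function.update h j (fun x => θ x * h j x) i) x) =
        Function.update (fun i => fderiv ℝ (h i) x) j
          (θ x • fderiv ℝ (h j) x + h j x • fderiv ℝ θ x) := by
      funext i
      rcases eq_or_ne i j with rfl | hij
      · simp only [Function.update_self]
        exact fderiv_fun_mul (hθ.differentiable (by simp) x) ((hh i).differentiable (by simp) x)
      · simp [hij]
    rw [h1, (detRows n).map_update_add, (detRows n).map_update_smul,
      (detRows n).map_update_smul, smul_eq_mul, smul_eq_mul]
    congr 3
    exact Function.update_eq_self j _
  simp_rw [hpt] at key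
  rw [integral_add] at key
  · linarith
  · exact (hθc.mul_right).integrable_of_continuous (hθ.continuous.mul hcont)
  · exact ((hc j).mul_right).integrable_of_continuous ((hh j).continuous.mul hcont2)

/-- A form of Young's inequality with the exponents `n` and `n / (n - 1)`. -/
theorem mul_pow_pred_le {n : ℕ} (hn : n ≠ 0) {a b t : ℝ} (ha : 0 ≤ a) (hb : 0 ≤ b) (ht : 0 < t) :
    a * b ^ (n - 1) ≤ a ^ n / t ^ (n - 1) + t * b ^ n := by
  obtain ⟨m, rfl⟩ := Nat.exists_eq_succ_of_ne_zero hn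
  simp only [Nat.succ_eq_add_one, Nat.add_sub_cancel]
  rcases le_total a (t * b) with h | h
  · calc a * b ^ m ≤ (t * b) * b ^ m := by gcongr
      _ = t * b ^ (m + 1) := by ring
      _ ≤ _ := le_add_of_nonneg_left (by positivity)
  · calc a * b ^ m ≤ a * (a / t) ^ m := by
          gcongr
          rwa [le_div_iff₀ ht, mul_comm]
      _ = a ^ (m + 1) / t ^ m := by rw [div_pow]; ring
      _ ≤ _ := le_add_of_nonneg_right (by positivity)

theorem mul_add_pow_pred_le {n : ℕ} (hn : n ≠ 0) {a b c t : ℝ} (ha : 0 ≤ a) (hb : 0 ≤ b)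
    (hc : 0 ≤ c) (ht : 0 < t) :
    a * (b + c) ^ (n - 1) ≤ a ^ n / t ^ (n - 1) + t * (2 ^ (n - 1) * (b ^ n + c ^ n)) :=
  (mul_pow_pred_le hn ha (add_nonneg hb hc) ht).trans
    (by gcongr; exact add_pow_le hb hc n)

theorem abs_integral_le_of_abs_le {n : ℕ} {F a b c : Rn n → ℝ} (ha : Integrable a)
    (hb : Integrable b) (hc : Integrable c) {K r s t : ℝ}
    (hF : ∀ x, |F x| ≤ K * (a x / s + t * (r * (b x + c x)))) :
    |∫ x, F x| ≤ K * ((∫ x, a x) / s + t * (r * ((∫ x, b x) + ∫ x, c x))) := by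
  have h1 : Integrable fun x => t * (r * (b x + c x)) := ((hb.add hc).const_mul _).const_mul _
  rw [← integral_add hb hc, ← integral_const_mul, ← integral_const_mul, ← integral_div,
    ← integral_add (ha.div_const _) h1, ← integral_const_mul]
  have h2 : Integrable fun x => K * (a x / s + t * (r * (b x + c x))) :=
    ((ha.div_const _).add h1).const_mul _
  exact norm_integral_le_of_norm_le (f := F) h2 (Eventually.of_forall hF)

theorem norm_proj_comp_le {n : ℕ} (A : Rn n →L[ℝ] Rn n) (i : Fin n) :
    ‖(EuclideanSpace.proj i).comp A‖ ≤ ‖A‖ := by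
  refine ContinuousLinearMap.opNorm_le_bound _ (norm_nonneg _) fun x => ?_
  exact (PiLp.norm_apply_le (A x) i).trans (A.le_opNorm x)

theorem abs_det_sub_det_le {n : ℕ} (A B : Rn n →L[ℝ] Rn n) :
    |A.det - B.det| ≤ ‖detRows n‖ * n * (‖A - B‖ * (‖A‖ + ‖B‖) ^ (n - 1)) := by
  rw [det_eq_detRows, det_eq_detRows]
  refine ((detRows n).norm_image_sub_le _ _).trans ?_
  rw [Fintype.card_fin, mul_assoc (_ * _), mul_comm (‖A - B‖)]
  have hA : ∀ A : Rn n →L[ℝ] Rn n, ‖fun i : Fin n => (EuclideanSpace.proj i).comp A‖ ≤ ‖A‖ :=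
    fun A => (pi_norm_le_iff_of_nonneg (norm_nonneg _)).2 fun i => norm_proj_comp_le A i
  gcongr
  · exact max_le ((hA A).trans (by simp)) ((hA B).trans (by simp))
  · refine le_trans (le_of_eq ?_) (hA (A - B))
    congr 1

theorem continuous_det {n : ℕ} : Continuous fun A : Rn n →L[ℝ] Rn n => A.det := by
  simp_rw [det_eq_detRows]
  exact (detRows n).cont.comp (continuous_pi fun i => continuous_const.clm_comp continuous_id)

theorem abs_det_le {n : ℕ} [NeZero n] (A : Rn n →L[ℝ] Rn n) :
    |A.det| ≤ ‖detRows n‖ * n * ‖A‖ ^ n := by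
  have h := abs_det_sub_det_le A 0
  have h0 : (0 : Rn n →L[ℝ] Rn n).det = 0 := by
    rw [ContinuousLinearMap.det, ContinuousLinearMap.toLinearMap_zero, LinearMap.det_zero]
    simp [NeZero.ne n]
  rw [h0, sub_zero, sub_zero, norm_zero, add_zero, mul_pow_sub_one (NeZero.ne n)] at h
  exact h

theorem integrable_det_of_memLp {n : ℕ} [NeZero n] {μ : Measure (Rn n)}
    {U : Rn n → (Rn n →L[ℝ] Rn n)} (hU : MemLp U n μ) : Integrable (fun x => (U x).det) μ :=
  ((hU.integrable_norm_pow (NeZero.ne n)).const_mul (‖detRows n‖ * n)).mono'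
    (continuous_det.comp_aestronglyMeasurable hU.1) (Eventually.of_forall fun x => abs_det_le (U x))

/-- The Jacobian depends continuously on the derivative in `L^n`. -/
theorem abs_integral_mul_det_sub_le {n : ℕ} [NeZero n] {θ : Rn n → ℝ} (hθ : Continuous θ)
    {B : ℝ} (hB : ∀ x, |θ x| ≤ B) {U V : Rn n → (Rn n →L[ℝ] Rn n)}
    (hU : MemLp U n) (hV : MemLp V n) {t : ℝ} (ht : 0 < t) :
    |(∫ x, θ x * (U x).det) - ∫ x, θ x * (V x).det| ≤ B * (‖detRows n‖ * n) *
      ((∫ x, ‖U x - V x‖ ^ n) / t ^ (n - 1) +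
        t * (2 ^ (n - 1) * ((∫ x, ‖U x‖ ^ n) + ∫ x, ‖V x‖ ^ n))) := by
  have hB0 : 0 ≤ B := (abs_nonneg _).trans (hB 0)
  have iU := hU.integrable_norm_pow (NeZero.ne n)
  have iV := hV.integrable_norm_pow (NeZero.ne n)
  have iUV : Integrable fun x => ‖U x - V x‖ ^ n :=
    (hU.sub hV).integrable_norm_pow (NeZero.ne n)
  have jU : Integrable fun x => θ x * (U x).det :=
    (integrable_det_of_memLp hU).bdd_mul hθ.aestronglyMeasurable (Eventually.of_forall hB)
  have jV : Integrable fun x => θ x * (V x).det :=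
    (integrable_det_of_memLp hV).bdd_mul hθ.aestronglyMeasurable (Eventually.of_forall hB)
  rw [← integral_sub jU jV]
  refine abs_integral_le_of_abs_le iUV iU iV fun x => ?_
  rw [← mul_sub, abs_mul]
  calc |θ x| * |(U x).det - (V x).det|
      ≤ B * (‖detRows n‖ * n * (‖U x - V x‖ * (‖U x‖ + ‖V x‖) ^ (n - 1))) :=
        mul_le_mul (hB x) (abs_det_sub_det_le _ _) (abs_nonneg _) hB0
    _ ≤ _ := by
        rw [mul_assoc B]
        gcongr
        exact mul_add_pow_pred_le (NeZero.ne n) (norm_nonneg _) (norm_nonneg _) (norm_nonneg _) ht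

theorem exists_norm_fderiv_le_of_hasCompactSupport {n : ℕ} {θ : Rn n → ℝ} (hθ : ContDiff ℝ ∞ θ)
    (hθc : HasCompactSupport θ) : ∃ C : ℝ, ∀ x, ‖fderiv ℝ θ x‖ ≤ C :=
  (hθc.fderiv ℝ).exists_bound_of_continuous (hθ.continuous_fderiv (by simp))

/-- For smooth mappings, the integrals of the Jacobians against a test function are controlled by
the distance of the mappings themselves, with no derivative of their difference: one component is
replaced at a time, and the derivative is moved to the test function. -/
theorem abs_integral_mul_det_fderiv_sub_le {n : ℕ} [NeZero n] {θ : Rn n → ℝ}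
    (hθ : ContDiff ℝ ∞ θ) (hθc : HasCompactSupport θ) {C : ℝ} (hC : ∀ x, ‖fderiv ℝ θ x‖ ≤ C)
    {u w : Rn n → Rn n} (hu : ContDiff ℝ ∞ u) (hw : ContDiff ℝ ∞ w)
    (huc : HasCompactSupport u) (hwc : HasCompactSupport w) {t : ℝ} (ht : 0 < t) :
    |(∫ x, θ x * (fderiv ℝ u x).det) - ∫ x, θ x * (fderiv ℝ w x).det| ≤
      n * (‖detRows n‖ * C * ((∫ x, ‖u x - w x‖ ^ n) / t ^ (n - 1) +
        t * (2 ^ (n - 1) * ((∫ x, ‖fderiv ℝ u x‖ ^ n) + ∫ x, ‖fderiv ℝ w x‖ ^ n)))) := by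
  have hC0 : 0 ≤ C := (norm_nonneg _).trans (hC 0)
  have hn := NeZero.ne n
  have cu := hu.continuous_fderiv (by simp)
  have cw := hw.continuous_fderiv (by simp)
  have hpow : ∀ {F : Type} [NormedAddCommGroup F] {f : Rn n → F}, HasCompactSupport f →
      HasCompactSupport fun x => ‖f x‖ ^ n := fun {F} _ {f} hf =>
    hf.comp_left (g := fun y : F => ‖y‖ ^ n) (by simp [hn])
  have iU : Integrable fun x => ‖fderiv ℝ u x‖ ^ n :=
    (hpow (huc.fderiv ℝ)).integrable_of_continuous (cu.norm.pow n)
  have iW : Integrable fun x => ‖fderiv ℝ w x‖ ^ n :=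
    (hpow (hwc.fderiv ℝ)).integrable_of_continuous (cw.norm.pow n)
  have iuw : Integrable fun x => ‖u x - w x‖ ^ n :=
    (hpow (huc.sub hwc)).integrable_of_continuous ((hu.continuous.sub hw.continuous).norm.pow n)
  -- the `i`-th intermediate mapping: components of `u`, then `u_i - w_i`, then components of `w`
  set h : Fin n → Fin n → Rn n → ℝ := fun i j x =>
    if j < i then u x j else if i = j then u x j - w x j else w x j with hh
  have us : ∀ j, ContDiff ℝ ∞ fun x => u x j := fun j =>
    (EuclideanSpace.proj (𝕜 := ℝ) j).contDiff.comp hu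
  have ws : ∀ j, ContDiff ℝ ∞ fun x => w x j := fun j =>
    (EuclideanSpace.proj (𝕜 := ℝ) j).contDiff.comp hw
  have ucs : ∀ j, HasCompactSupport fun x => u x j := fun j =>
    huc.comp_left (g := fun y : Rn n => y j) (by simp)
  have wcs : ∀ j, HasCompactSupport fun x => w x j := fun j =>
    hwc.comp_left (g := fun y : Rn n => y j) (by simp)
  have hs : ∀ i j, ContDiff ℝ ∞ (h i j) := fun i j => by
    simp only [hh]
    split_ifs
    exacts [us j, (us j).sub (ws j), ws j]
  have hcs : ∀ i j, HasCompactSupport (h i j) := fun i j => by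
    simp only [hh]
    split_ifs
    exacts [ucs j, (ucs j).sub (wcs j), wcs j]
  have hproj : ∀ {v : Rn n → Rn n}, ContDiff ℝ ∞ v → ∀ j x,
      fderiv ℝ (fun y => v y j) x = (EuclideanSpace.proj j).comp (fderiv ℝ v x) := by
    intro v hv j x
    exact ((EuclideanSpace.proj (𝕜 := ℝ) j).hasFDerivAt.comp x
      (hv.differentiable (by simp) x).hasFDerivAt).fderiv
  have hfd : ∀ i j x, fderiv ℝ (h i j) x =
      if j < i then (EuclideanSpace.proj j).comp (fderiv ℝ u x) else
      if i = j then (EuclideanSpace.proj j).comp (fderiv ℝ u x) -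
        (EuclideanSpace.proj j).comp (fderiv ℝ w x)
      else (EuclideanSpace.proj j).comp (fderiv ℝ w x) := by
    intro i j x
    simp only [hh]
    split_ifs
    · exact hproj hu j x
    · rw [← hproj hu, ← hproj hw]
      exact fderiv_fun_sub ((us j).differentiable (by simp) x) ((ws j).differentiable (by simp) x)
    · exact hproj hw j x
  have hfc : ∀ i, Continuous fun x => fun j => fderiv ℝ (h i j) x := fun i =>
    continuous_pi fun j => (hs i j).continuous_fderiv (by simp)
  have htel : ∀ x, (fderiv ℝ u x).det - (fderiv ℝ w x).det =
      ∑ i, detRows n fun j => fderiv ℝ (h i j) x := by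
    intro x
    have := (detRows n).toMultilinearMap.map_sub_map_piecewise
      (fun i => (EuclideanSpace.proj i).comp (fderiv ℝ u x))
      (fun i => (EuclideanSpace.proj i).comp (fderiv ℝ w x)) Finset.univ
    simp only [Finset.piecewise_univ, Finset.mem_univ, true_imp_iff] at this
    rw [det_eq_detRows, det_eq_detRows]
    refine this.trans (Finset.sum_congr rfl fun i _ => ?_)
    simp_rw [hfd]
    rfl
  have hdcont : ∀ {v : Rn n → Rn n}, ContDiff ℝ ∞ v →
      Integrable fun x => θ x * (fderiv ℝ v x).det := fun {v} hv =>
    (hθc.mul_right).integrable_of_continuous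
      (hθ.continuous.mul (continuous_det.comp (hv.continuous_fderiv (by simp))))
  rw [← integral_sub (hdcont hu) (hdcont hw)]
  simp_rw [← mul_sub, htel, Finset.mul_sum]
  have hint : ∀ i, Integrable fun x => θ x * detRows n fun j => fderiv ℝ (h i j) x := fun i =>
    (hθc.mul_right).integrable_of_continuous
      (hθ.continuous.mul ((detRows n).cont.comp (hfc i)))
  rw [integral_finsetSum _ fun i _ => hint i]
  refine (Finset.abs_sum_le_sum_abs _ _).trans ?_
  refine (Finset.sum_le_card_nsmul _ _ _ fun i _ => ?_).trans
    (le_of_eq (by rw [Finset.card_univ, Fintype.card_fin, nsmul_eq_mul]))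
  rw [integral_mul_detRows_fderiv (hs i) (hcs i) hθ hθc i, abs_neg]
  refine abs_integral_le_of_abs_le iuw iU iW fun x => ?_
  rw [abs_mul]
  have h1 : |h i i x| ≤ ‖u x - w x‖ := by
    simp only [hh, lt_irrefl, if_false, if_true]
    exact PiLp.norm_apply_le (u x - w x) i
  have h2 : |detRows n (Function.update (fun j => fderiv ℝ (h i j) x) i (fderiv ℝ θ x))| ≤
      ‖detRows n‖ * (C * (‖fderiv ℝ u x‖ + ‖fderiv ℝ w x‖) ^ (n - 1)) := by
    refine ((detRows n).le_opNorm _).trans ?_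
    gcongr
    rw [← Finset.mul_prod_erase Finset.univ _ (Finset.mem_univ i), Function.update_self]
    refine mul_le_mul (hC x) ?_ (Finset.prod_nonneg fun _ _ => norm_nonneg _) hC0
    refine (Finset.prod_le_prod (g := fun _ => ‖fderiv ℝ u x‖ + ‖fderiv ℝ w x‖)
      (fun _ _ => norm_nonneg _) fun j hj => ?_).trans (le_of_eq ?_)
    · have hji : j ≠ i := (Finset.mem_erase.1 hj).1
      rw [Function.update_of_ne hji, hfd]
      have e1 := norm_proj_comp_le (fderiv ℝ u x) j
      have e2 := norm_proj_comp_le (fderiv ℝ w x) j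
      have e3 := norm_nonneg (fderiv ℝ u x)
      have e4 := norm_nonneg (fderiv ℝ w x)
      rw [if_neg hji.symm]
      split_ifs <;> linarith
    · rw [Finset.prod_const, Finset.card_erase_of_mem (Finset.mem_univ i), Finset.card_univ,
        Fintype.card_fin]
  calc |h i i x| * |detRows n (Function.update (fun j => fderiv ℝ (h i j) x) i (fderiv ℝ θ x))|
      ≤ ‖u x - w x‖ * (‖detRows n‖ * (C * (‖fderiv ℝ u x‖ + ‖fderiv ℝ w x‖) ^ (n - 1))) :=
        mul_le_mul h1 h2 (abs_nonneg _) (norm_nonneg _)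
    _ = ‖detRows n‖ * C * (‖u x - w x‖ * (‖fderiv ℝ u x‖ + ‖fderiv ℝ w x‖) ^ (n - 1)) := by ring
    _ ≤ _ := by
        gcongr
        exact mul_add_pow_pred_le hn (norm_nonneg _) (norm_nonneg _) (norm_nonneg _) ht

/-! ### Mollification in `L^n` -/

theorem eLpNorm_natCast_pow {α F : Type*} [MeasurableSpace α] [NormedAddCommGroup F]
    {n : ℕ} [NeZero n] (μ : Measure α) (f : α → F) :
    eLpNorm f n μ ^ n = ∫⁻ x, ‖f x‖ₑ ^ n ∂μ := by
  have hn : (n : ℝ) ≠ 0 := Nat.cast_ne_zero.2 (NeZero.ne n)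
  rw [eLpNorm_eq_lintegral_rpow_enorm_toReal (by simpa using NeZero.ne n) (by simp),
    ← ENNReal.rpow_natCast, ← ENNReal.rpow_mul]
  simp [hn]

theorem ofReal_integral_norm_pow {α F : Type*} [MeasurableSpace α] [NormedAddCommGroup F]
    {n : ℕ} [NeZero n] {μ : Measure α} {f : α → F} (hf : MemLp f n μ) :
    ENNReal.ofReal (∫ x, ‖f x‖ ^ n ∂μ) = ∫⁻ x, ‖f x‖ₑ ^ n ∂μ := by
  rw [ofReal_integral_eq_lintegral_ofReal (hf.integrable_norm_pow (NeZero.ne n))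
    (Eventually.of_forall fun x => by positivity)]
  refine lintegral_congr fun x => ?_
  rw [ENNReal.ofReal_pow (norm_nonneg _), ofReal_norm]

theorem memLp_natCast_of_lintegral {α F : Type*} [MeasurableSpace α] [NormedAddCommGroup F]
    {n : ℕ} [NeZero n] {μ : Measure α} {f : α → F} (hf : AEStronglyMeasurable f μ)
    (h : ∫⁻ x, ‖f x‖ₑ ^ n ∂μ < ⊤) : MemLp f n μ := by
  refine ⟨hf, ?_⟩
  rw [← eLpNorm_natCast_pow] at h
  exact (ENNReal.pow_lt_top_iff.1 h).resolve_right (NeZero.ne n)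

theorem integral_norm_pow_le_of_lintegral_le {α F G : Type*} [MeasurableSpace α]
    [NormedAddCommGroup F] [NormedAddCommGroup G]
    {n : ℕ} [NeZero n] {μ : Measure α} {f : α → F} {g : α → G} (hf : MemLp f n μ)
    (hg : MemLp g n μ) {c : ℝ} (hc : 0 ≤ c)
    (h : ∫⁻ x, ‖f x‖ₑ ^ n ∂μ ≤ ENNReal.ofReal c * ∫⁻ x, ‖g x‖ₑ ^ n ∂μ) :
    ∫ x, ‖f x‖ ^ n ∂μ ≤ c * ∫ x, ‖g x‖ ^ n ∂μ := by
  rw [← ofReal_integral_norm_pow hf, ← ofReal_integral_norm_pow hg, ← ENNReal.ofReal_mul hc] at h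
  exact (ENNReal.ofReal_le_ofReal_iff
    (mul_nonneg hc (integral_nonneg fun x => by positivity))).1 h

/-- Jensen's inequality for powers and a probability measure. -/
theorem lintegral_pow_le_lintegral_pow {T : Type*} [MeasurableSpace T] {n : ℕ} [NeZero n]
    (ν : Measure T) [IsProbabilityMeasure ν] {f : T → ℝ≥0∞} (hf : AEMeasurable f ν) :
    (∫⁻ t, f t ∂ν) ^ n ≤ ∫⁻ t, f t ^ n ∂ν := by
  have hn : (1 : ℝ) ≤ n := by exact_mod_cast NeZero.one_le
  have h := ENNReal.lintegral_mul_le_Lp_mul_Lq ν (p := n) (q := Real.conjExponent n)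
  rcases hn.eq_or_lt with h1 | h1
  · have : n = 1 := by exact_mod_cast h1.symm
    simp [this]
  · have hpq := Real.HolderConjugate.conjExponent h1
    have h2 := h hpq hf (aemeasurable_const (b := (1 : ℝ≥0∞)))
    simp only [Pi.mul_apply, mul_one, ENNReal.one_rpow, lintegral_const, measure_univ,
      ENNReal.rpow_natCast] at h2
    calc (∫⁻ t, f t ∂ν) ^ n ≤ ((∫⁻ t, f t ^ n ∂ν) ^ (1 / (n : ℝ))) ^ n :=
          pow_le_pow_left' h2 n
      _ = _ := by
          rw [← ENNReal.rpow_natCast, ← ENNReal.rpow_mul, one_div,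
            inv_mul_cancel₀ (by positivity), ENNReal.rpow_one]

/-- The `n`-th power of an average is controlled, after integration in the remaining variable,
by the largest of the averaged integrals. -/
theorem lintegral_lintegral_pow_le {X T : Type*} [MeasurableSpace X] [MeasurableSpace T]
    {n : ℕ} [NeZero n] (μ : Measure X) [SFinite μ] (ν : Measure T) [IsProbabilityMeasure ν]
    {f : X × T → ℝ≥0∞} (hf : AEMeasurable f (μ.prod ν)) {A : ℝ≥0∞}
    (hA : ∀ᵐ t ∂ν, ∫⁻ x, f (x, t) ^ n ∂μ ≤ A) :
    ∫⁻ x, (∫⁻ t, f (x, t) ∂ν) ^ n ∂μ ≤ A := by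
  have h1 : ∀ᵐ x ∂μ, AEMeasurable (fun t => f (x, t)) ν :=
    hf.aestronglyMeasurable.prodMk_left.mono fun x hx => hx.aemeasurable
  calc ∫⁻ x, (∫⁻ t, f (x, t) ∂ν) ^ n ∂μ ≤ ∫⁻ x, ∫⁻ t, f (x, t) ^ n ∂ν ∂μ :=
        lintegral_mono_ae (h1.mono fun x hx => lintegral_pow_le_lintegral_pow ν hx)
    _ = ∫⁻ t, ∫⁻ x, f (x, t) ^ n ∂μ ∂ν := lintegral_lintegral_swap (hf.pow_const n)
    _ ≤ ∫⁻ _, A ∂ν := lintegral_mono_ae hA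
    _ = A := by simp

/-- The mollification `x ↦ ∫ ρ(t) g(x - t) dt` of `g` by the normalized bump function `ρ`. -/
def mollify {n : ℕ} {F : Type*} [NormedAddCommGroup F] [NormedSpace ℝ F]
    (ρ : ContDiffBump (0 : Rn n)) (g : Rn n → F) (x : Rn n) : F :=
  ∫ t, ρ.normed volume t • g (x - t)

/-- The probability measure with density the normalized bump function. -/
def bumpMeasure {n : ℕ} (ρ : ContDiffBump (0 : Rn n)) : Measure (Rn n) :=
  volume.withDensity fun t => ENNReal.ofReal (ρ.normed volume t)

instance isProbabilityMeasure_bumpMeasure {n : ℕ} (ρ : ContDiffBump (0 : Rn n)) :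
    IsProbabilityMeasure (bumpMeasure ρ) := ⟨by
  rw [bumpMeasure, withDensity_apply _ MeasurableSet.univ, Measure.restrict_univ,
    ← ofReal_integral_eq_lintegral_ofReal ρ.integrable_normed
      (Eventually.of_forall fun x => ρ.nonneg_normed x), ρ.integral_normed, ENNReal.ofReal_one]⟩

theorem ae_bumpMeasure_norm_lt {n : ℕ} (ρ : ContDiffBump (0 : Rn n)) :
    ∀ᵐ t ∂bumpMeasure ρ, ‖t‖ < ρ.rOut := by
  rw [bumpMeasure, ae_withDensity_iff
    (ρ.continuous_normed.measurable.ennreal_ofReal)]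
  refine Eventually.of_forall fun t ht => ?_
  have : t ∈ Function.support (ρ.normed volume) := fun h0 => ht (by simp [h0])
  simpa [ρ.support_normed_eq] using this

theorem enorm_integral_normed_smul_le {F : Type*} [NormedAddCommGroup F] [NormedSpace ℝ F]
    {n : ℕ} (ρ : ContDiffBump (0 : Rn n)) {k : Rn n → F} :
    ‖∫ t, ρ.normed volume t • k t‖ₑ ≤ ∫⁻ t, ‖k t‖ₑ ∂bumpMeasure ρ := by
  refine (enorm_integral_le_lintegral_enorm _).trans (le_of_eq ?_)
  rw [bumpMeasure, lintegral_withDensity_eq_lintegral_mul_non_measurable _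
    ρ.continuous_normed.measurable.ennreal_ofReal (Eventually.of_forall fun x => by simp)]
  refine lintegral_congr fun t => ?_
  rw [enorm_smul, Pi.mul_apply, Real.enorm_of_nonneg (ρ.nonneg_normed t)]

theorem aestronglyMeasurable_sub_prod {F : Type*} [NormedAddCommGroup F]
    {n : ℕ} (ρ : ContDiffBump (0 : Rn n)) {g : Rn n → F}
    (hg : AEStronglyMeasurable g) :
    AEStronglyMeasurable (fun p : Rn n × Rn n => g (p.1 - p.2))
      (volume.prod (bumpMeasure ρ)) :=
  (hg.comp_quasiMeasurePreserving
    (quasiMeasurePreserving_sub_of_right_invariant volume volume)).mono_ac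
    (Measure.AbsolutelyContinuous.rfl.prod (withDensity_absolutelyContinuous _ _))

theorem lintegral_enorm_mollify_pow_le {F : Type*} [NormedAddCommGroup F] [NormedSpace ℝ F]
    {n : ℕ} [NeZero n] (ρ : ContDiffBump (0 : Rn n))
    {g : Rn n → F} (hg : AEStronglyMeasurable g) :
    ∫⁻ x, ‖mollify ρ g x‖ₑ ^ n ≤ ∫⁻ x, ‖g x‖ₑ ^ n := by
  refine le_trans (lintegral_mono fun x => pow_le_pow_left' (enorm_integral_normed_smul_le ρ) n)
    (lintegral_lintegral_pow_le volume (bumpMeasure ρ)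
      (f := fun p => ‖g (p.1 - p.2)‖ₑ) (aestronglyMeasurable_sub_prod ρ hg).enorm
      (Eventually.of_forall fun t => ?_))
  exact (lintegral_sub_right_eq_self (fun x => ‖g x‖ₑ ^ n) t).le

theorem integrable_normed_smul {F : Type*} [NormedAddCommGroup F] [NormedSpace ℝ F]
    {n : ℕ} (ρ : ContDiffBump (0 : Rn n))
    {g : Rn n → F} (hg : LocallyIntegrable g) (x : Rn n) :
    Integrable fun t => ρ.normed volume t • g (x - t) :=
  ρ.hasCompactSupport_normed.convolutionExists_left (ContinuousLinearMap.lsmul ℝ ℝ)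
    ρ.continuous_normed hg x

theorem mollify_sub_self {F : Type*} [NormedAddCommGroup F]
    [NormedSpace ℝ F] [CompleteSpace F] {n : ℕ} (ρ : ContDiffBump (0 : Rn n))
    {g : Rn n → F} (hg : LocallyIntegrable g) (x : Rn n) :
    mollify ρ g x - g x = ∫ t, ρ.normed volume t • (g (x - t) - g x) := by
  simp_rw [smul_sub]
  rw [integral_sub (integrable_normed_smul ρ hg x) (ρ.integrable_normed.smul_const _),
    integral_smul_const, ρ.integral_normed, one_smul]
  rfl

theorem mollify_sub {F : Type*} [NormedAddCommGroup F]
    [NormedSpace ℝ F] [CompleteSpace F] {n : ℕ} (ρ : ContDiffBump (0 : Rn n))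
    {g h : Rn n → F} (hg : LocallyIntegrable g) (hh : LocallyIntegrable h) (x : Rn n) :
    mollify ρ g x - mollify ρ h x = mollify ρ (fun y => g y - h y) x := by
  simp only [mollify, smul_sub]
  rw [integral_sub (integrable_normed_smul ρ hg x) (integrable_normed_smul ρ hh x)]

/-- The distance of a mollification from the function is controlled by the translations of the
function by vectors in the support of the kernel. -/
theorem lintegral_enorm_mollify_sub_self_le {F : Type*} [NormedAddCommGroup F]
    [NormedSpace ℝ F] [CompleteSpace F] {n : ℕ} [NeZero n]
    (ρ : ContDiffBump (0 : Rn n)) {g : Rn n → F} (hg : LocallyIntegrable g) {A : ℝ≥0∞}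
    (hA : ∀ t, ‖t‖ < ρ.rOut → ∫⁻ x, ‖g (x - t) - g x‖ₑ ^ n ≤ A) :
    ∫⁻ x, ‖mollify ρ g x - g x‖ₑ ^ n ≤ A := by
  simp_rw [mollify_sub_self ρ hg]
  refine le_trans (lintegral_mono fun x => pow_le_pow_left' (enorm_integral_normed_smul_le ρ) n)
    (lintegral_lintegral_pow_le volume (bumpMeasure ρ)
      (f := fun p => ‖g (p.1 - p.2) - g p.1‖ₑ) ?_
      ((ae_bumpMeasure_norm_lt ρ).mono hA))
  exact ((aestronglyMeasurable_sub_prod ρ hg.aestronglyMeasurable).sub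
    hg.aestronglyMeasurable.comp_fst).enorm

/-- Translations of a smooth function: `‖g(· - t) - g‖_n ≤ |t| ‖Dg‖_n`. -/
theorem lintegral_enorm_translate_sub_le {F : Type*} [NormedAddCommGroup F]
    [NormedSpace ℝ F] [CompleteSpace F] {n : ℕ} [NeZero n] {g : Rn n → F}
    (hg : ContDiff ℝ 1 g) (t : Rn n) :
    ∫⁻ x, ‖g (x - t) - g x‖ₑ ^ n ≤ ‖t‖ₑ ^ n * ∫⁻ x, ‖fderiv ℝ g x‖ₑ ^ n := by
  have hc := hg.continuous_fderiv (by simp)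
  set ν : Measure ℝ := volume.restrict (Set.Ioc 0 1) with hν
  have : IsProbabilityMeasure ν := ⟨by simp [hν]⟩
  have hpt : ∀ x, ‖g (x - t) - g x‖ₑ ≤ ∫⁻ s, ‖fderiv ℝ g (x - s • t)‖ₑ * ‖t‖ₑ ∂ν := by
    intro x
    have hd : ∀ s : ℝ, HasDerivAt (fun s : ℝ => g (x - s • t)) (-(fderiv ℝ g (x - s • t) t)) s := by
      intro s
      have h1 : HasDerivAt (fun s : ℝ => x - s • t) (-t) s := by
        simpa using ((hasDerivAt_id s).smul_const t).const_sub x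
      have h2 := (hg.differentiable (by simp) (x - s • t)).hasFDerivAt.comp_hasDerivAt s h1
      simpa [Function.comp_def] using h2
    have hcs : Continuous fun s : ℝ => -(fderiv ℝ g (x - s • t) t) := by fun_prop
    have h3 := intervalIntegral.integral_eq_sub_of_hasDerivAt (a := 0) (b := 1)
      (fun s _ => hd s) (hcs.intervalIntegrable _ _)
    simp only [one_smul, zero_smul, sub_zero] at h3
    rw [← h3, intervalIntegral.integral_of_le zero_le_one]
    refine (enorm_integral_le_lintegral_enorm _).trans (lintegral_mono fun s => ?_)
    rw [enorm_neg]
    exact (fderiv ℝ g (x - s • t)).le_opENorm t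
  refine le_trans (lintegral_mono fun x => pow_le_pow_left' (hpt x) n)
    (lintegral_lintegral_pow_le volume ν
      (f := fun p => ‖fderiv ℝ g (p.1 - p.2 • t)‖ₑ * ‖t‖ₑ) ?_ (Eventually.of_forall fun s => ?_))
  · have : Continuous fun p : Rn n × ℝ => fderiv ℝ g (p.1 - p.2 • t) := by fun_prop
    exact (this.aestronglyMeasurable.enorm).mul_const _
  · simp_rw [mul_pow]
    rw [lintegral_mul_const' _ _ (by simp),
      lintegral_sub_right_eq_self (fun x => ‖fderiv ℝ g x‖ₑ ^ n), mul_comm]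

theorem lintegral_enorm_mollify_sub_self_le_fderiv {F : Type*} [NormedAddCommGroup F]
    [NormedSpace ℝ F] [CompleteSpace F] {n : ℕ} [NeZero n]
    (ρ : ContDiffBump (0 : Rn n)) {g : Rn n → F} (hg : ContDiff ℝ 1 g) :
    ∫⁻ x, ‖mollify ρ g x - g x‖ₑ ^ n ≤
      ENNReal.ofReal (ρ.rOut ^ n) * ∫⁻ x, ‖fderiv ℝ g x‖ₑ ^ n := by
  refine lintegral_enorm_mollify_sub_self_le ρ hg.continuous.locallyIntegrable fun t ht =>
    (lintegral_enorm_translate_sub_le hg t).trans ?_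
  gcongr
  rw [ENNReal.ofReal_pow ρ.rOut_pos.le, ← ofReal_norm]
  gcongr

theorem tendsto_lintegral_enorm_translate_sub {F : Type*} [NormedAddCommGroup F] [NormedSpace ℝ F]
    {n : ℕ} [NeZero n] {g : Rn n → F}
    (hg : MemLp g n) :
    Tendsto (fun t => ∫⁻ x, ‖g (x - t) - g x‖ₑ ^ n) (𝓝 0) (𝓝 0) := by
  set τ : Rn n → C(Rn n, Rn n) := fun t => ⟨fun x => x - t, by fun_prop⟩ with hτ
  have hτc : Continuous τ :=
    ContinuousMap.continuous_of_continuous_uncurry _ (by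
      simp only [hτ, Function.uncurry_def, ContinuousMap.coe_mk]; fun_prop)
  have hm : ∀ t, MeasurePreserving (τ t) := fun t => measurePreserving_sub_right volume t
  have h1 := (continuous_const (y := hg.toLp g)).compMeasurePreservingLp hτc hm (by simp)
  have h2 := (h1.tendsto 0)
  rw [tendsto_iff_edist_tendsto_0] at h2
  have h3 : ∀ t, edist (Lp.compMeasurePreserving (τ t) (hm t) (hg.toLp g))
      (Lp.compMeasurePreserving (τ 0) (hm 0) (hg.toLp g)) ^ n =
      ∫⁻ x, ‖g (x - t) - g x‖ₑ ^ n := by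
    intro t
    rw [Lp.toLp_compMeasurePreserving, Lp.toLp_compMeasurePreserving, Lp.edist_toLp_toLp,
      eLpNorm_natCast_pow]
    simp [hτ]
  simp_rw [← h3]
  have h4 := (ENNReal.continuous_pow n).tendsto 0 |>.comp h2
  simpa [NeZero.ne n, Function.comp_def] using h4

/-- Mollifications of a function of class `L^n` converge to it in `L^n`. -/
theorem tendsto_lintegral_enorm_mollify_sub_self {F : Type*} [NormedAddCommGroup F]
    [NormedSpace ℝ F] [CompleteSpace F] {n : ℕ} [NeZero n]
    {g : Rn n → F} (hg : MemLp g n) {ρ : ℕ → ContDiffBump (0 : Rn n)}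
    (hρ : Tendsto (fun m => (ρ m).rOut) atTop (𝓝 0)) :
    Tendsto (fun m => ∫⁻ x, ‖mollify (ρ m) g x - g x‖ₑ ^ n) atTop (𝓝 0) := by
  have hloc : LocallyIntegrable g := hg.locallyIntegrable (by exact_mod_cast NeZero.one_le)
  refine ENNReal.tendsto_nhds_zero.2 fun ε hε => ?_
  have h1 := ENNReal.tendsto_nhds_zero.1 (tendsto_lintegral_enorm_translate_sub hg) ε hε
  obtain ⟨δ, hδ, h2⟩ := Metric.eventually_nhds_iff.1 h1
  filter_upwards [hρ.eventually (gt_mem_nhds hδ)] with m hm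
  exact lintegral_enorm_mollify_sub_self_le (ρ m) hloc fun t ht => h2 (by simpa using ht.trans hm)

/-! ### Jacobians of mollified Sobolev mappings -/

theorem mollify_eq_convolution {n : ℕ} {F : Type*} [NormedAddCommGroup F] [NormedSpace ℝ F]
    (ρ : ContDiffBump (0 : Rn n)) (g : Rn n → F) :
    mollify ρ g = MeasureTheory.convolution (ρ.normed volume) g
      (ContinuousLinearMap.lsmul ℝ ℝ) volume := rfl

theorem contDiff_mollify {n : ℕ} {F : Type*} [NormedAddCommGroup F] [NormedSpace ℝ F]
    [CompleteSpace F] (ρ : ContDiffBump (0 : Rn n)) {g : Rn n → F} (hg : LocallyIntegrable g) :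
    ContDiff ℝ ∞ (mollify ρ g) := by
  rw [mollify_eq_convolution]
  exact ρ.hasCompactSupport_normed.contDiff_convolution_left _ ρ.contDiff_normed hg

theorem HasCompactSupport.mollify {n : ℕ} {F : Type*} [NormedAddCommGroup F] [NormedSpace ℝ F]
    (ρ : ContDiffBump (0 : Rn n)) {g : Rn n → F} (hg : HasCompactSupport g) :
    HasCompactSupport (mollify ρ g) := by
  rw [mollify_eq_convolution]
  exact HasCompactSupport.convolution _ ρ.hasCompactSupport_normed hg

theorem memLp_mollify {n : ℕ} [NeZero n] {F : Type*} [NormedAddCommGroup F] [NormedSpace ℝ F]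
    [CompleteSpace F] (ρ : ContDiffBump (0 : Rn n)) {g : Rn n → F} (hg : MemLp g n) :
    MemLp (mollify ρ g) n := by
  refine memLp_natCast_of_lintegral (contDiff_mollify ρ
    (hg.locallyIntegrable (by exact_mod_cast NeZero.one_le))).continuous.aestronglyMeasurable ?_
  refine (lintegral_enorm_mollify_pow_le ρ hg.1).trans_lt ?_
  rw [← eLpNorm_natCast_pow]
  exact ENNReal.pow_lt_top hg.2

theorem fderiv_mollify_apply {n : ℕ} (ρ : ContDiffBump (0 : Rn n)) {u : Rn n → Rn n}
    (hu : LocallyIntegrable u) (x v : Rn n) :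
    fderiv ℝ (mollify ρ u) x v = ∫ y, (fderiv ℝ (ρ.normed volume) (x - y) v) • u y := by
  have hρ : ContDiff ℝ 1 (ρ.normed (volume : Measure (Rn n))) := ρ.contDiff_normed
  have hc := ρ.hasCompactSupport_normed (μ := (volume : Measure (Rn n)))
  have h1 := (hc.hasFDerivAt_convolution_left (ContinuousLinearMap.lsmul ℝ ℝ) hρ hu x).fderiv
  rw [mollify_eq_convolution, h1, convolution_eq_swap]
  have hint := (hc.fderiv ℝ).convolutionExists_left
    ((ContinuousLinearMap.lsmul ℝ ℝ : ℝ →L[ℝ] Rn n →L[ℝ] Rn n).precompL (Rn n))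
    (hρ.continuous_fderiv (by simp)) hu x
  rw [ContinuousLinearMap.integral_apply]
  · rfl
  · exact hint.integrable_swap

/-- The derivative of the mollification is the mollification of the weak derivative. -/
theorem IsWeakDeriv.fderiv_mollify {n : ℕ} {u : Rn n → Rn n} {U : Rn n → (Rn n →L[ℝ] Rn n)}
    (h : IsWeakDeriv Set.univ u U) (ρ : ContDiffBump (0 : Rn n)) (x : Rn n) :
    fderiv ℝ (mollify ρ u) x = mollify ρ U x := by
  have hu := locallyIntegrableOn_univ.1 h.locInt
  have hU := locallyIntegrableOn_univ.1 h.locInt_deriv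
  have hρ : ContDiff ℝ ∞ (ρ.normed (volume : Measure (Rn n))) := ρ.contDiff_normed
  have hc := ρ.hasCompactSupport_normed (μ := (volume : Measure (Rn n)))
  ext1 v
  rw [fderiv_mollify_apply ρ hu]
  have hfd : ∀ y, fderiv ℝ (fun y => ρ.normed volume (x - y)) y v =
      -fderiv ℝ (ρ.normed volume) (x - y) v := fun y => by
    have h1 := (hρ.differentiable (by simp) (x - y)).hasFDerivAt.comp y
      ((hasFDerivAt_id y).const_sub x)
    have h2 : HasFDerivAt (fun y => ρ.normed volume (x - y))
      ((fderiv ℝ (ρ.normed volume) (x - y)).comp (-ContinuousLinearMap.id ℝ (Rn n))) y := h1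
    rw [h2.fderiv]
    simp
  have h3 := h.integral_eq (fun y => ρ.normed volume (x - y))
    (hρ.comp (contDiff_const.sub contDiff_id))
    (hc.comp_homeomorph (Homeomorph.subLeft x)) (Set.subset_univ _) v
  simp only [hfd, Measure.restrict_univ, neg_smul, integral_neg, neg_inj] at h3
  rw [h3]
  have hi := integrable_normed_smul ρ hU x
  rw [mollify, ContinuousLinearMap.integral_apply hi]
  exact integral_sub_left_eq_self (fun t => ρ.normed volume t • U (x - t) v) volume x |>.symm.trans
    (by simp) |>.symm

theorem ContDiff.isWeakDeriv {n : ℕ} {u : Rn n → Rn n} (hu : ContDiff ℝ ∞ u) :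
    IsWeakDeriv Set.univ u (fderiv ℝ u) := by
  have hc := hu.continuous_fderiv (by simp)
  refine ⟨locallyIntegrableOn_univ.2 hu.continuous.locallyIntegrable,
    locallyIntegrableOn_univ.2 hc.locallyIntegrable, fun θ hθ hθc _ v => ?_⟩
  rw [Measure.restrict_univ, integral_smul_fderiv_eq_neg_fderiv_smul_of_integrable, neg_neg]
  · exact ((hθc.fderiv_apply ℝ v).smul_right).integrable_of_continuous
      (((hθ.continuous_fderiv (by simp)).clm_apply continuous_const).smul hu.continuous)
  · exact (hθc.smul_right).integrable_of_continuous
      (hθ.continuous.smul (hc.clm_apply continuous_const))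
  · exact (hθc.smul_right).integrable_of_continuous (hθ.continuous.smul hu.continuous)
  · exact fun x _ => hθ.differentiable (by simp) x
  · exact fun x _ => hu.differentiable (by simp) x

theorem integral_norm_mollify_pow_le {n : ℕ} [NeZero n] {F : Type*} [NormedAddCommGroup F]
    [NormedSpace ℝ F] [CompleteSpace F] (ρ : ContDiffBump (0 : Rn n)) {g : Rn n → F}
    (hg : MemLp g n) : ∫ x, ‖mollify ρ g x‖ ^ n ≤ ∫ x, ‖g x‖ ^ n := by
  have := integral_norm_pow_le_of_lintegral_le (memLp_mollify ρ hg) hg zero_le_one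
    (by simpa using lintegral_enorm_mollify_pow_le ρ hg.1)
  simpa using this

/-- Mollification at scale `ε` changes the distributional Jacobian of a smooth mapping by `O(ε)`,
with a constant that depends only on the test function and the `L^n` norm of the derivative. -/
theorem abs_integral_mul_det_mollify_sub_le_of_contDiff {n : ℕ} [NeZero n] {θ : Rn n → ℝ}
    (hθ : ContDiff ℝ ∞ θ) (hθc : HasCompactSupport θ) {C : ℝ} (hC : ∀ x, ‖fderiv ℝ θ x‖ ≤ C)
    {u : Rn n → Rn n} (hu : ContDiff ℝ ∞ u) (huc : HasCompactSupport u)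
    (ρ : ContDiffBump (0 : Rn n)) :
    |(∫ x, θ x * (mollify ρ (fderiv ℝ u) x).det) - ∫ x, θ x * (fderiv ℝ u x).det| ≤
      n * (‖detRows n‖ * C * (1 + 2 ^ n)) * ρ.rOut * ∫ x, ‖fderiv ℝ u x‖ ^ n := by
  have hC0 : 0 ≤ C := (norm_nonneg _).trans (hC 0)
  have hε := ρ.rOut_pos
  have hn := NeZero.ne n
  have hDu : MemLp (fderiv ℝ u) n :=
    (hu.continuous_fderiv (by simp)).memLp_of_hasCompactSupport (huc.fderiv ℝ)
  have hul : MemLp u n := hu.continuous.memLp_of_hasCompactSupport huc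
  have hmu := memLp_mollify ρ hul
  -- Young's inequality with the parameter `t = ε` balances `∫ |ρ_ε * u - u|^n ≤ ε^n ∫ |Du|^n`
  have h1 := abs_integral_mul_det_fderiv_sub_le hθ hθc hC
    (contDiff_mollify ρ hu.continuous.locallyIntegrable) hu (huc.mollify ρ) huc hε
  simp_rw [hu.isWeakDeriv.fderiv_mollify ρ] at h1
  refine h1.trans ?_
  have h2 := integral_norm_pow_le_of_lintegral_le (hmu.sub hul) hDu (pow_nonneg hε.le n)
    (lintegral_enorm_mollify_sub_self_le_fderiv ρ (hu.of_le (by simp)))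
  have h3 := integral_norm_mollify_pow_le ρ hDu
  set I := ∫ x, ‖fderiv ℝ u x‖ ^ n with hI
  simp only [Pi.sub_apply] at h2
  calc _ ≤ n * (‖detRows n‖ * C * (ρ.rOut ^ n * I / ρ.rOut ^ (n - 1) +
        ρ.rOut * (2 ^ (n - 1) * (I + I)))) := by gcongr
    _ = _ := by
      obtain ⟨m, rfl⟩ := Nat.exists_eq_succ_of_ne_zero hn
      simp only [Nat.succ_eq_add_one, Nat.add_sub_cancel]
      field_simp
      ring

/-- The Jacobians converge in the sense of distributions if the derivatives converge
in `L^n`. -/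
theorem tendsto_integral_mul_det_of_tendsto_lintegral {n : ℕ} [NeZero n] {θ : Rn n → ℝ}
    (hθ : Continuous θ) (hθc : HasCompactSupport θ) {V : ℕ → Rn n → (Rn n →L[ℝ] Rn n)}
    {W : Rn n → (Rn n →L[ℝ] Rn n)} (hV : ∀ m, MemLp (V m) n) (hW : MemLp W n) {N : ℝ}
    (hN : ∀ m, ∫ x, ‖V m x‖ ^ n ≤ N)
    (h : Tendsto (fun m => ∫⁻ x, ‖V m x - W x‖ₑ ^ n) atTop (𝓝 0)) :
    Tendsto (fun m => ∫ x, θ x * (V m x).det) atTop (𝓝 (∫ x, θ x * (W x).det)) := by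
  obtain ⟨B, hB⟩ := hθc.exists_bound_of_continuous hθ
  have hB0 : 0 ≤ B := (norm_nonneg _).trans (hB 0)
  have hd : Tendsto (fun m => ∫ x, ‖V m x - W x‖ ^ n) atTop (𝓝 0) := by
    have h1 := (ENNReal.tendsto_toReal ENNReal.zero_ne_top).comp h
    refine (h1.congr fun m => ?_)
    have h2 := ofReal_integral_norm_pow ((hV m).sub hW)
    simp only [Pi.sub_apply] at h2
    rw [Function.comp_apply, ← h2, ENNReal.toReal_ofReal (integral_nonneg fun x => by positivity)]
  set c := 2 ^ (n - 1) * (N + ∫ x, ‖W x‖ ^ n) with hc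
  set K := B * (‖detRows n‖ * n) with hK
  have hK0 : 0 ≤ K := by positivity
  rw [tendsto_iff_dist_tendsto_zero]
  refine tendsto_order.2 ⟨fun a ha => Eventually.of_forall fun m => ha.trans_le dist_nonneg,
    fun a ha => ?_⟩
  obtain ⟨t, ht, hta⟩ : ∃ t : ℝ, 0 < t ∧ K * (0 / t ^ (n - 1) + t * c) < a := by
    have h1 : Tendsto (fun t : ℝ => K * (0 / t ^ (n - 1) + t * c)) (𝓝[>] 0) (𝓝 0) := by
      have h2 : Continuous fun t : ℝ => K * (t * c) := by fun_prop
      simpa using (h2.tendsto' 0 0 (by simp)).mono_left nhdsWithin_le_nhds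
    obtain ⟨t, h2, h3⟩ := ((h1.eventually (gt_mem_nhds ha)).and self_mem_nhdsWithin).exists
    exact ⟨t, h3, h2⟩
  have h4 : Tendsto (fun m => K * ((∫ x, ‖V m x - W x‖ ^ n) / t ^ (n - 1) + t * c)) atTop
      (𝓝 (K * (0 / t ^ (n - 1) + t * c))) :=
    ((hd.div_const _).add_const _).const_mul _
  filter_upwards [h4.eventually (gt_mem_nhds hta)] with m hm
  refine lt_of_le_of_lt ?_ hm
  rw [Real.dist_eq]
  refine (abs_integral_mul_det_sub_le hθ hB (hV m) hW ht).trans ?_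
  gcongr
  rw [hc]
  gcongr
  exact hN m

/-- Smooth kernels whose supports shrink to a point, with a fixed ratio of radii as required by the
Lebesgue differentiation theorem. -/
theorem exists_contDiffBump_seq (n : ℕ) :
    ∃ ρ : ℕ → ContDiffBump (0 : Rn n), Tendsto (fun m => (ρ m).rOut) atTop (𝓝 0) ∧
      ∀ m, (ρ m).rOut = 2 * (ρ m).rIn := by
  refine ⟨fun m => ⟨1 / (m + 1), 2 * (1 / (m + 1)), by positivity, ?_⟩, ?_, fun m => rfl⟩
  · have : (0 : ℝ) < 1 / (m + 1) := by positivity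
    linarith
  · simpa using (tendsto_one_div_add_atTop_nhds_zero_nat (𝕜 := ℝ)).const_mul 2

/-- Mollification at scale `ε` changes the distributional Jacobian of a compactly supported
mapping of class `W^1_n` by `O(ε)`, uniformly on bounded sets of mappings. -/
theorem IsWeakDeriv.abs_integral_mul_det_mollify_sub_le {n : ℕ} [NeZero n] {θ : Rn n → ℝ}
    (hθ : ContDiff ℝ ∞ θ) (hθc : HasCompactSupport θ) {C : ℝ} (hC : ∀ x, ‖fderiv ℝ θ x‖ ≤ C)
    {u : Rn n → Rn n} {U : Rn n → (Rn n →L[ℝ] Rn n)} (h : IsWeakDeriv Set.univ u U)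
    (huc : HasCompactSupport u) (hU : MemLp U n) (ρ : ContDiffBump (0 : Rn n)) :
    |(∫ x, θ x * (mollify ρ U x).det) - ∫ x, θ x * (U x).det| ≤
      n * (‖detRows n‖ * C * (1 + 2 ^ n)) * ρ.rOut * ∫ x, ‖U x‖ ^ n := by
  have hC0 : 0 ≤ C := (norm_nonneg _).trans (hC 0)
  have hu := locallyIntegrableOn_univ.1 h.locInt
  have hone : (1 : ℝ≥0∞) ≤ n := by exact_mod_cast NeZero.one_le
  -- apply the estimate to the smooth mappings `σ_m * u`, and let `m → ∞`
  obtain ⟨σ, hσ, -⟩ := exists_contDiffBump_seq n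
  have hmU : ∀ m, MemLp (mollify (σ m) U) n := fun m => memLp_mollify (σ m) hU
  have hfd : ∀ m, fderiv ℝ (mollify (σ m) u) = mollify (σ m) U := fun m =>
    funext fun x => h.fderiv_mollify (σ m) x
  have hN : ∀ m, ∫ x, ‖mollify (σ m) U x‖ ^ n ≤ ∫ x, ‖U x‖ ^ n := fun m =>
    integral_norm_mollify_pow_le (σ m) hU
  have hconv := tendsto_lintegral_enorm_mollify_sub_self hU hσ
  have t1 := tendsto_integral_mul_det_of_tendsto_lintegral hθ.continuous hθc hmU hU hN hconv
  have t2 := tendsto_integral_mul_det_of_tendsto_lintegral hθ.continuous hθc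
    (fun m => memLp_mollify ρ (hmU m)) (memLp_mollify ρ hU)
    (fun m => (integral_norm_mollify_pow_le ρ (hmU m)).trans (hN m))
    (by
      refine tendsto_of_tendsto_of_tendsto_of_le_of_le tendsto_const_nhds hconv
        (fun _ => zero_le) fun m => ?_
      simp_rw [mollify_sub ρ ((hmU m).locallyIntegrable hone) (hU.locallyIntegrable hone)]
      exact lintegral_enorm_mollify_pow_le ρ ((hmU m).sub hU).1)
  refine le_of_tendsto (t2.sub t1).abs (Eventually.of_forall fun m => ?_)
  have h1 := abs_integral_mul_det_mollify_sub_le_of_contDiff hθ hθc hC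
    (contDiff_mollify (σ m) hu) (huc.mollify (σ m)) ρ
  rw [hfd] at h1
  have := ρ.rOut_pos
  exact h1.trans (mul_le_mul_of_nonneg_left (hN m) (by positivity))

/-! ### Localization -/

theorem exists_contDiff_cutoff {n : ℕ} {K Ω : Set (Rn n)} (hK : IsCompact K) (hΩ : IsOpen Ω)
    (hKΩ : K ⊆ Ω) : ∃ χ : Rn n → ℝ, ContDiff ℝ ∞ χ ∧ HasCompactSupport χ ∧ tsupport χ ⊆ Ω ∧
      (∀ x, 0 ≤ χ x) ∧ ∀ x ∈ K, χ =ᶠ[𝓝 x] 1 := by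
  obtain ⟨L, hL, hKL, hLΩ⟩ := exists_compact_between hK hΩ hKΩ
  obtain ⟨L', hL', hLL', hL'Ω⟩ := exists_compact_between hL hΩ hLΩ
  obtain ⟨χ, h1, h2, h3, h4⟩ := exists_contMDiff_support_eq_eq_one_iff (n := (⊤ : ℕ∞))
    (modelWithCornersSelf ℝ (Rn n)) isOpen_interior hL.isClosed hLL'
  have hts : tsupport χ ⊆ L' := by
    rw [tsupport, h3]
    exact closure_minimal interior_subset hL'.isClosed
  refine ⟨χ, h1.contDiff, hL'.of_isClosed_subset (isClosed_tsupport χ) hts, hts.trans hL'Ω,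
    fun x => (h2 ⟨x, rfl⟩).1, fun x hx => ?_⟩
  filter_upwards [mem_interior_iff_mem_nhds.1 (hKL hx)] with y hy
  exact (h4 y).1 hy

/-- The weak derivative `χ Df + f ⊗ Dχ` of the product `χ f`. -/
def cutoffDeriv {n : ℕ} (χ : Rn n → ℝ) (f : Rn n → Rn n) (D : Rn n → (Rn n →L[ℝ] Rn n))
    (x : Rn n) : Rn n →L[ℝ] Rn n :=
  χ x • D x + (fderiv ℝ χ x).smulRight (f x)

theorem cutoffDeriv_eq_zero {n : ℕ} {χ : Rn n → ℝ} {f : Rn n → Rn n}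
    {D : Rn n → (Rn n →L[ℝ] Rn n)} {x : Rn n} (hx : x ∉ tsupport χ) :
    cutoffDeriv χ f D x = 0 := by
  have h1 : fderiv ℝ χ x = 0 :=
    image_eq_zero_of_notMem_tsupport fun h => hx (tsupport_fderiv_subset ℝ h)
  rw [cutoffDeriv, image_eq_zero_of_notMem_tsupport hx, h1]
  ext; simp

theorem cutoffDeriv_eq {n : ℕ} {χ : Rn n → ℝ} {f : Rn n → Rn n}
    {D : Rn n → (Rn n →L[ℝ] Rn n)} {x : Rn n} (hx : χ =ᶠ[𝓝 x] 1) :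
    cutoffDeriv χ f D x = D x := by
  have h1 : fderiv ℝ χ x = 0 := by
    rw [hx.fderiv_eq]
    exact fderiv_const_apply 1
  rw [cutoffDeriv, hx.eq_of_nhds, h1]
  ext; simp

theorem memLp_of_memLp_restrict {n : ℕ} {F : Type*} [NormedAddCommGroup F] {p : ℝ≥0∞}
    {Ω : Set (Rn n)} (hΩ : MeasurableSet Ω) {g : Rn n → F} (hg : MemLp g p (volume.restrict Ω))
    (h0 : ∀ x ∉ Ω, g x = 0) : MemLp g p := by
  have h1 : Ω.indicator g = g := Set.indicator_eq_self.2 fun x hx => by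
    by_contra h
    exact hx (h0 x h)
  rw [← h1]
  exact (memLp_indicator_iff_restrict hΩ).2 hg

theorem aestronglyMeasurable_cutoffDeriv {n : ℕ} {μ : Measure (Rn n)} {χ : Rn n → ℝ}
    (hχ : ContDiff ℝ ∞ χ) {f : Rn n → Rn n} {D : Rn n → (Rn n →L[ℝ] Rn n)}
    (hf : AEStronglyMeasurable f μ) (hD : AEStronglyMeasurable D μ) :
    AEStronglyMeasurable (cutoffDeriv χ f D) μ := by
  refine (hχ.continuous.aestronglyMeasurable.smul hD).add ?_
  exact (ContinuousLinearMap.smulRightL ℝ (Rn n) (Rn n)).aestronglyMeasurable_comp₂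
    (hχ.continuous_fderiv (by simp)).aestronglyMeasurable hf

theorem IsWeakDeriv.cutoff {n : ℕ} {Ω : Set (Rn n)} (hΩ : MeasurableSet Ω) {f : Rn n → Rn n}
    {D : Rn n → (Rn n →L[ℝ] Rn n)} (h : IsWeakDeriv Ω f D) {χ : Rn n → ℝ}
    (hχ : ContDiff ℝ ∞ χ) (hχc : HasCompactSupport χ) (hχΩ : tsupport χ ⊆ Ω) :
    IsWeakDeriv Set.univ (fun x => χ x • f x) (cutoffDeriv χ f D) := by
  have hoff : ∀ {x}, x ∉ Ω → x ∉ tsupport χ := fun hx h => hx (hχΩ h)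
  have i1 : Integrable (fun x => χ x • f x) (volume.restrict Ω) :=
    integrableOn_smul_of_test hχ.continuous hχc hχΩ h.locInt
  have hcd := hχ.continuous_fderiv (by simp)
  have i2 : Integrable (fun x => ‖fderiv ℝ χ x‖ • f x) (volume.restrict Ω) :=
    integrableOn_smul_of_test hcd.norm (hχc.fderiv ℝ).norm
      ((closure_mono (by simp)).trans ((tsupport_fderiv_subset ℝ).trans hχΩ)) h.locInt
  have i3 : Integrable (cutoffDeriv χ f D) (volume.restrict Ω) := by
    refine (integrableOn_smul_of_test hχ.continuous hχc hχΩ h.locInt_deriv).add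
      (i2.norm.mono' ?_ (Eventually.of_forall fun x => ?_))
    · exact (ContinuousLinearMap.smulRightL ℝ (Rn n) (Rn n)).aestronglyMeasurable_comp₂
        hcd.aestronglyMeasurable h.locInt.aestronglyMeasurable
    · simp [ContinuousLinearMap.norm_smulRight_apply, norm_smul]
  have j1 := memLp_of_memLp_restrict hΩ (memLp_one_iff_integrable.2 i1)
    (fun x hx => by simp [image_eq_zero_of_notMem_tsupport (hoff hx)])
  have j3 := memLp_of_memLp_restrict hΩ (memLp_one_iff_integrable.2 i3)
    (fun x hx => cutoffDeriv_eq_zero (hoff hx))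
  refine ⟨(memLp_one_iff_integrable.1 j1).locallyIntegrable.locallyIntegrableOn _,
    (memLp_one_iff_integrable.1 j3).locallyIntegrable.locallyIntegrableOn _,
    fun θ hθ hθc _ v => ?_⟩
  have hθd := hθ.continuous_fderiv (by simp)
  have hprod := h.integral_eq (fun x => θ x * χ x) (hθ.mul hχ) (hχc.mul_left)
    ((tsupport_mul_subset_right).trans hχΩ) v
  have hfd : ∀ x, fderiv ℝ (fun x => θ x * χ x) x v =
      θ x * fderiv ℝ χ x v + χ x * fderiv ℝ θ x v := fun x => by
    rw [fderiv_fun_mul (hθ.differentiable (by simp) x) (hχ.differentiable (by simp) x)]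
    simp
  simp_rw [hfd] at hprod
  have s1 : ∫ x, fderiv ℝ θ x v • χ x • f x = ∫ x in Ω, fderiv ℝ θ x v • χ x • f x :=
    (setIntegral_eq_integral_of_forall_compl_eq_zero
      (fun x hx => by simp [image_eq_zero_of_notMem_tsupport (hoff hx)])).symm
  have s2 : ∫ x, θ x • cutoffDeriv χ f D x v = ∫ x in Ω, θ x • cutoffDeriv χ f D x v :=
    (setIntegral_eq_integral_of_forall_compl_eq_zero
      (fun x hx => by simp [cutoffDeriv_eq_zero (hoff hx)])).symm
  have tχ : ∀ {g : Rn n → ℝ}, tsupport (fun x => g x * χ x) ⊆ Ω := fun {g} =>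
    (tsupport_mul_subset_right).trans hχΩ
  have k1 : Integrable (fun x => (θ x * fderiv ℝ χ x v) • f x) (volume.restrict Ω) :=
    integrableOn_smul_of_test (hθ.continuous.mul (hcd.clm_apply continuous_const))
      ((hχc.fderiv_apply ℝ v).mul_left)
      ((tsupport_mul_subset_right).trans ((tsupport_fderiv_apply_subset ℝ v).trans hχΩ)) h.locInt
  have k2 : Integrable (fun x => (fderiv ℝ θ x v * χ x) • f x) (volume.restrict Ω) :=
    integrableOn_smul_of_test ((hθd.clm_apply continuous_const).mul hχ.continuous)
      (hχc.mul_left) tχ h.locInt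
  have k3 : Integrable (fun x => (θ x * χ x) • D x v) (volume.restrict Ω) :=
    (integrableOn_smul_of_test (hθ.continuous.mul hχ.continuous)
      (hχc.mul_left) tχ h.locInt_deriv).apply_continuousLinearMap v
  have e1 : ∫ x in Ω, (θ x * fderiv ℝ χ x v + χ x * fderiv ℝ θ x v) • f x =
      (∫ x in Ω, (θ x * fderiv ℝ χ x v) • f x) + ∫ x in Ω, (fderiv ℝ θ x v * χ x) • f x := by
    rw [← integral_add k1 k2]
    simp_rw [← add_smul, mul_comm (χ _)]
  have e2 : ∫ x in Ω, θ x • (cutoffDeriv χ f D x) v =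
      (∫ x in Ω, (θ x * χ x) • D x v) + ∫ x in Ω, (θ x * fderiv ℝ χ x v) • f x := by
    rw [← integral_add k3 k1]
    refine integral_congr_ae (Eventually.of_forall fun x => ?_)
    simp [cutoffDeriv, smul_smul]
  have e3 : ∫ x in Ω, fderiv ℝ θ x v • χ x • f x =
      ∫ x in Ω, (fderiv ℝ θ x v * χ x) • f x := by simp_rw [smul_smul]
  rw [Measure.restrict_univ, s1, s2, e2, e3, neg_add]
  rw [e1] at hprod
  rw [← hprod]
  abel

theorem norm_cutoffDeriv_le {n : ℕ} {χ : Rn n → ℝ} {f : Rn n → Rn n}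
    {D : Rn n → (Rn n →L[ℝ] Rn n)} {B : ℝ} (h1 : ∀ x, |χ x| ≤ B) (h2 : ∀ x, ‖fderiv ℝ χ x‖ ≤ B)
    (x : Rn n) : ‖cutoffDeriv χ f D x‖ ≤ B * (‖D x‖ + ‖f x‖) := by
  refine (norm_add_le _ _).trans ?_
  rw [norm_smul, ContinuousLinearMap.norm_smulRight_apply, mul_add]
  exact add_le_add (mul_le_mul_of_nonneg_right (h1 x) (norm_nonneg _))
    (mul_le_mul_of_nonneg_right (h2 x) (norm_nonneg _))

theorem memLp_cutoffDeriv {n : ℕ} [NeZero n] {Ω : Set (Rn n)} (hΩ : MeasurableSet Ω)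
    {f : Rn n → Rn n} {D : Rn n → (Rn n →L[ℝ] Rn n)} {χ : Rn n → ℝ} (hχ : ContDiff ℝ ∞ χ)
    (hχΩ : tsupport χ ⊆ Ω) {B : ℝ} (h1 : ∀ x, |χ x| ≤ B) (h2 : ∀ x, ‖fderiv ℝ χ x‖ ≤ B)
    (hf : MemLp f n (volume.restrict Ω)) (hD : MemLp D n (volume.restrict Ω)) :
    MemLp (cutoffDeriv χ f D) n := by
  refine memLp_of_memLp_restrict hΩ ?_ fun x hx => cutoffDeriv_eq_zero fun h => hx (hχΩ h)
  refine (hD.norm.add hf.norm).of_le_mul (c := B) (aestronglyMeasurable_cutoffDeriv hχ hf.1 hD.1)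
    (Eventually.of_forall fun x => (norm_cutoffDeriv_le h1 h2 x).trans_eq ?_)
  rw [Pi.add_apply, Real.norm_of_nonneg (by positivity)]

theorem integral_norm_cutoffDeriv_pow_le {n : ℕ} [NeZero n] {Ω : Set (Rn n)}
    {f : Rn n → Rn n} {D : Rn n → (Rn n →L[ℝ] Rn n)} {χ : Rn n → ℝ}
    (hχΩ : tsupport χ ⊆ Ω) {B : ℝ} (h1 : ∀ x, |χ x| ≤ B) (h2 : ∀ x, ‖fderiv ℝ χ x‖ ≤ B)
    (hf : MemLp f n (volume.restrict Ω)) (hD : MemLp D n (volume.restrict Ω)) :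
    ∫ x, ‖cutoffDeriv χ f D x‖ ^ n ≤ B ^ n * (2 ^ (n - 1) *
      ((∫ x in Ω, ‖D x‖ ^ n) + ∫ x in Ω, ‖f x‖ ^ n)) := by
  have hB : 0 ≤ B := (abs_nonneg _).trans (h1 0)
  have iD := hD.integrable_norm_pow (NeZero.ne n)
  have jf := hf.integrable_norm_pow (NeZero.ne n)
  rw [← setIntegral_eq_integral_of_forall_compl_eq_zero (s := Ω)
      (fun x hx => by simp [cutoffDeriv_eq_zero (D := D) (f := f) fun h => hx (hχΩ h),
        NeZero.ne n]),
    ← integral_add iD jf, ← integral_const_mul, ← integral_const_mul]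
  refine integral_mono_of_nonneg
    (Eventually.of_forall fun x => by simp only [Pi.zero_apply]; positivity)
    (((iD.add jf).const_mul _).const_mul _) (Eventually.of_forall fun x => ?_)
  calc ‖cutoffDeriv χ f D x‖ ^ n ≤ (B * (‖D x‖ + ‖f x‖)) ^ n := by
        gcongr; exact norm_cutoffDeriv_le h1 h2 x
    _ ≤ B ^ n * (2 ^ (n - 1) * (‖D x‖ ^ n + ‖f x‖ ^ n)) := by
        rw [mul_pow]
        gcongr
        exact add_pow_le (norm_nonneg _) (norm_nonneg _) n

/-! ### Convergence of Jacobians in the sense of distributions -/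

theorem tendsto_det {n : ℕ} {A : ℕ → Rn n →L[ℝ] Rn n} {B : Rn n →L[ℝ] Rn n}
    (h : ∀ v, Tendsto (fun k => A k v) atTop (𝓝 (B v))) :
    Tendsto (fun k => (A k).det) atTop (𝓝 B.det) := by
  simp_rw [det_eq_detRows, detRows_apply]
  have hc : Continuous fun M : Matrix (Fin n) (Fin n) ℝ => M.det :=
    continuous_id.matrix_det
  refine (hc.tendsto _).comp (tendsto_pi_nhds.2 fun i => tendsto_pi_nhds.2 fun j => ?_)
  exact ((EuclideanSpace.proj (𝕜 := ℝ) i).continuous.tendsto _).comp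
    (h (EuclideanSpace.single j 1))

/-- At a fixed scale, mollifications are bounded uniformly on bounded subsets of `L^n`; the bound
uses only `y ≤ 1 + y ^ n`. -/
theorem norm_mollify_le {n : ℕ} [NeZero n] {F : Type*} [NormedAddCommGroup F] [NormedSpace ℝ F]
    (ρ : ContDiffBump (0 : Rn n)) {R : ℝ} (hR : ∀ x, ρ.normed volume x ≤ R) {g : Rn n → F}
    (hg : MemLp g n) (x : Rn n) : ‖mollify ρ g x‖ ≤ 1 + R * ∫ y, ‖g y‖ ^ n := by
  have ig := hg.integrable_norm_pow (NeZero.ne n)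
  have ig' : Integrable fun t => ‖g (x - t)‖ ^ n := ig.comp_sub_left x
  have hle : ∀ t, ‖ρ.normed volume t • g (x - t)‖ ≤ ρ.normed volume t + R * ‖g (x - t)‖ ^ n := by
    intro t
    rw [norm_smul, Real.norm_of_nonneg (ρ.nonneg_normed t)]
    have h0 := ρ.nonneg_normed (μ := (volume : Measure (Rn n))) t
    have h1 : ‖g (x - t)‖ ≤ 1 + ‖g (x - t)‖ ^ n := by
      rcases le_total ‖g (x - t)‖ 1 with h | h
      · exact h.trans (le_add_of_nonneg_right (by positivity))
      · exact (le_self_pow₀ h (NeZero.ne n)).trans (le_add_of_nonneg_left zero_le_one)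
    calc ρ.normed volume t * ‖g (x - t)‖ ≤ ρ.normed volume t * (1 + ‖g (x - t)‖ ^ n) := by gcongr
      _ = ρ.normed volume t + ρ.normed volume t * ‖g (x - t)‖ ^ n := by ring
      _ ≤ _ := by gcongr; exact hR t
  refine (norm_integral_le_of_norm_le (ρ.integrable_normed.add (ig'.const_mul R))
    (Eventually.of_forall hle)).trans (le_of_eq ?_)
  simp only [Pi.add_apply]
  rw [integral_add ρ.integrable_normed (ig'.const_mul R), ρ.integral_normed, integral_const_mul,
    integral_sub_left_eq_self (fun y => ‖g y‖ ^ n) volume x]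

/-- If mappings converge weakly and are bounded in `W^1_n`, then their Jacobians converge in the
sense of distributions: mollification at a fixed scale makes the derivatives converge
pointwise, and changes the integrals by little, uniformly in the sequence. -/
theorem tendsto_integral_mul_det {n : ℕ} [NeZero n] {Ω : Set (Rn n)} (hΩ : IsOpen Ω)
    {f : ℕ → Rn n → Rn n} {f₀ : Rn n → Rn n}
    {D : ℕ → Rn n → (Rn n →L[ℝ] Rn n)} {D₀ : Rn n → (Rn n →L[ℝ] Rn n)}
    (hw : ∀ k, IsWeakDeriv Ω (f k) (D k)) (hw₀ : IsWeakDeriv Ω f₀ D₀)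
    (hf : ∀ k, MemLp (f k) n (volume.restrict Ω)) (hf₀ : MemLp f₀ n (volume.restrict Ω))
    (hD : ∀ k, MemLp (D k) n (volume.restrict Ω)) (hD₀ : MemLp D₀ n (volume.restrict Ω))
    {N : ℝ} (hfN : ∀ k, ∫ x in Ω, ‖f k x‖ ^ n ≤ N) (hDN : ∀ k, ∫ x in Ω, ‖D k x‖ ^ n ≤ N)
    (hconv : ∀ g : Rn n → ℝ, Continuous g → HasCompactSupport g → tsupport g ⊆ Ω →
      Tendsto (fun k => ∫ x in Ω, g x • f k x) atTop (𝓝 (∫ x in Ω, g x • f₀ x)))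
    {θ : Rn n → ℝ} (hθ : ContDiff ℝ ∞ θ) (hθc : HasCompactSupport θ) (hθΩ : tsupport θ ⊆ Ω) :
    Tendsto (fun k => ∫ x in Ω, θ x * (D k x).det) atTop (𝓝 (∫ x in Ω, θ x * (D₀ x).det)) := by
  obtain ⟨C, hC⟩ := exists_norm_fderiv_le_of_hasCompactSupport hθ hθc
  have hC0 : 0 ≤ C := (norm_nonneg _).trans (hC 0)
  have hΩm := hΩ.measurableSet
  obtain ⟨χ, hχ, hχc, hχΩ, -, hχ1⟩ := exists_contDiff_cutoff hθc hΩ hθΩ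
  obtain ⟨B₁, hB₁⟩ := hχc.exists_bound_of_continuous hχ.continuous
  obtain ⟨B₂, hB₂⟩ := exists_norm_fderiv_le_of_hasCompactSupport hχ hχc
  set B := max B₁ B₂
  have hb₁ : ∀ x, |χ x| ≤ B := fun x => (hB₁ x).trans (le_max_left _ _)
  have hb₂ : ∀ x, ‖fderiv ℝ χ x‖ ≤ B := fun x => (hB₂ x).trans (le_max_right _ _)
  have hB : 0 ≤ B := (abs_nonneg _).trans (hb₁ 0)
  -- pass to the compactly supported mappings `χ f_k` on the whole space
  have hloc : ∀ (g : Rn n → Rn n) (E : Rn n → (Rn n →L[ℝ] Rn n)),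
      ∫ x in Ω, θ x * (E x).det = ∫ x, θ x * (cutoffDeriv χ g E x).det := by
    intro g E
    rw [setIntegral_eq_integral_of_forall_compl_eq_zero (fun x hx => by
      simp [image_eq_zero_of_notMem_tsupport fun h => hx (hθΩ h)])]
    refine integral_congr_ae (Eventually.of_forall fun x => ?_)
    by_cases hx : x ∈ tsupport θ
    · simp only [cutoffDeriv_eq (hχ1 x hx)]
    · simp [image_eq_zero_of_notMem_tsupport hx]
  rw [hloc f₀ D₀]
  simp_rw [fun k => hloc (f k) (D k)]
  set U : ℕ → Rn n → (Rn n →L[ℝ] Rn n) := fun k => cutoffDeriv χ (f k) (D k) with hU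
  set U₀ : Rn n → (Rn n →L[ℝ] Rn n) := cutoffDeriv χ f₀ D₀ with hU₀
  have hwU : ∀ k, IsWeakDeriv Set.univ (fun x => χ x • f k x) (U k) := fun k =>
    (hw k).cutoff hΩm hχ hχc hχΩ
  have hwU₀ : IsWeakDeriv Set.univ (fun x => χ x • f₀ x) U₀ := hw₀.cutoff hΩm hχ hχc hχΩ
  have hLp : ∀ k, MemLp (U k) n := fun k => memLp_cutoffDeriv hΩm hχ hχΩ hb₁ hb₂ (hf k) (hD k)
  have hLp₀ : MemLp U₀ n := memLp_cutoffDeriv hΩm hχ hχΩ hb₁ hb₂ hf₀ hD₀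
  obtain ⟨N', hN', hN'₀⟩ : ∃ N', (∀ k, ∫ x, ‖U k x‖ ^ n ≤ N') ∧ ∫ x, ‖U₀ x‖ ^ n ≤ N' := by
    refine ⟨max (B ^ n * (2 ^ (n - 1) * (N + N))) (∫ x, ‖U₀ x‖ ^ n), fun k => ?_,
      le_max_right _ _⟩
    refine ((integral_norm_cutoffDeriv_pow_le hχΩ hb₁ hb₂ (hf k) (hD k)).trans ?_).trans
      (le_max_left _ _)
    gcongr
    exacts [hDN k, hfN k]
  have hN'0 : 0 ≤ N' := (integral_nonneg fun x => by positivity).trans hN'₀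
  -- convergence of the mollified Jacobians, at a fixed scale
  have hmoll : ∀ ρ : ContDiffBump (0 : Rn n), Tendsto (fun k => ∫ x, θ x * (mollify ρ (U k) x).det)
      atTop (𝓝 (∫ x, θ x * (mollify ρ U₀ x).det)) := by
    intro ρ
    obtain ⟨R, hR⟩ := (ρ.hasCompactSupport_normed (μ :=
      (volume : Measure (Rn n)))).exists_bound_of_continuous ρ.continuous_normed
    have hR' : ∀ x, ρ.normed volume x ≤ R := fun x => (le_abs_self _).trans (hR x)
    have hR0 : 0 ≤ R := (norm_nonneg _).trans (hR 0)
    have hone : (1 : ℝ≥0∞) ≤ n := by exact_mod_cast NeZero.one_le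
    have hmc : ∀ k, Continuous (mollify ρ (U k)) := fun k =>
      (contDiff_mollify ρ ((hLp k).locallyIntegrable hone)).continuous
    refine tendsto_integral_of_dominated_convergence
      (fun x => |θ x| * (‖detRows n‖ * n * (1 + R * N') ^ n))
      (fun k => (hθ.continuous.mul (continuous_det.comp (hmc k))).aestronglyMeasurable)
      ((hθ.continuous.integrable_of_hasCompactSupport hθc).abs.mul_const _)
      (fun k => Eventually.of_forall fun x => ?_) (Eventually.of_forall fun x => ?_)
    · rw [Real.norm_eq_abs, abs_mul]
      refine mul_le_mul_of_nonneg_left ((abs_det_le _).trans ?_) (abs_nonneg _)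
      have h1 := (norm_mollify_le ρ hR' (hLp k) x).trans
        (add_le_add_right (mul_le_mul_of_nonneg_left (hN' k) hR0) 1)
      gcongr
    · refine (tendsto_det fun v => ?_).const_mul _
      have hval : ∀ {g : Rn n → Rn n} {E : Rn n → (Rn n →L[ℝ] Rn n)},
          IsWeakDeriv Set.univ (fun x => χ x • g x) E → mollify ρ E x v =
          ∫ y in Ω, (fderiv ℝ (ρ.normed volume) (x - y) v * χ y) • g y := by
        intro g E hE
        rw [← hE.fderiv_mollify ρ, fderiv_mollify_apply ρ (locallyIntegrableOn_univ.1 hE.locInt),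
          setIntegral_eq_integral_of_forall_compl_eq_zero (fun y hy => by
            simp [image_eq_zero_of_notMem_tsupport fun h => hy (hχΩ h)])]
        simp_rw [smul_smul]
      rw [hval hwU₀]
      simp_rw [fun k => hval (hwU k)]
      refine hconv _ (Continuous.mul ?_ hχ.continuous) hχc.mul_left
        (tsupport_mul_subset_right.trans hχΩ)
      have hρ : ContDiff ℝ 1 (ρ.normed (volume : Measure (Rn n))) := ρ.contDiff_normed
      exact ((hρ.continuous_fderiv (by simp)).comp (continuous_const.sub continuous_id)).clm_apply
        continuous_const
  set K := n * (‖detRows n‖ * C * (1 + 2 ^ n)) with hK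
  have hK0 : 0 ≤ K := by positivity
  refine Metric.tendsto_atTop'.2 fun ε hε => ?_
  obtain ⟨σ, hσ, -⟩ := exists_contDiffBump_seq n
  obtain ⟨m, hm⟩ : ∃ m, K * (σ m).rOut * N' < ε / 3 := by
    have h1 := ((hσ.const_mul K).mul_const N')
    rw [mul_zero, zero_mul] at h1
    exact (h1.eventually (gt_mem_nhds (by positivity))).exists
  obtain ⟨k₀, hk₀⟩ := Metric.tendsto_atTop'.1 (hmoll (σ m)) (ε / 3) (by positivity)
  refine ⟨k₀, fun k hk => ?_⟩
  have hbound : ∀ {g : Rn n → Rn n} {E : Rn n → (Rn n →L[ℝ] Rn n)},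
      IsWeakDeriv Set.univ (fun x => χ x • g x) E → MemLp E n → ∫ x, ‖E x‖ ^ n ≤ N' →
      |(∫ x, θ x * (mollify (σ m) E x).det) - ∫ x, θ x * (E x).det| < ε / 3 := by
    intro g E hE hEL hEN
    refine lt_of_le_of_lt ?_ hm
    refine (hE.abs_integral_mul_det_mollify_sub_le hθ hθc hC hχc.smul_right hEL (σ m)).trans ?_
    exact mul_le_mul_of_nonneg_left hEN (mul_nonneg hK0 (σ m).rOut_pos.le)
  have e1 := abs_lt.1 (hbound (hwU k) (hLp k) (hN' k))
  have e2 := abs_lt.1 (hbound hwU₀ hLp₀ hN'₀)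
  have e3 := hk₀ k hk
  rw [Real.dist_eq] at e3 ⊢
  have e3' := abs_lt.1 e3
  rw [abs_lt]
  constructor <;> linarith [e1.1, e1.2, e2.1, e2.2, e3'.1, e3'.2]

/-! ### Weak convergence in the Sobolev space -/

theorem tendsto_apply_of_tendsto_toWeakSpace {E : Type*} [NormedAddCommGroup E] [NormedSpace ℝ E]
    {x : ℕ → E} {x₀ : E}
    (h : Tendsto (fun k => toWeakSpace ℝ E (x k)) atTop (𝓝 (toWeakSpace ℝ E x₀)))
    (L : StrongDual ℝ E) : Tendsto (fun k => L (x k)) atTop (𝓝 (L x₀)) :=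
  ((WeakBilin.eval_continuous (topDualPairing ℝ E).flip L).tendsto _).comp h

/-- Weakly convergent sequences are bounded, by the uniform boundedness principle. -/
theorem exists_norm_le_of_tendsto_toWeakSpace {E : Type*} [NormedAddCommGroup E] [NormedSpace ℝ E]
    {x : ℕ → E} {x₀ : E}
    (h : Tendsto (fun k => toWeakSpace ℝ E (x k)) atTop (𝓝 (toWeakSpace ℝ E x₀))) :
    ∃ C, ∀ k, ‖x k‖ ≤ C := by
  obtain ⟨C, hC⟩ := banach_steinhaus (g := fun k => NormedSpace.inclusionInDoubleDual ℝ E (x k))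
    (fun L => by
      obtain ⟨C, hC⟩ := (tendsto_apply_of_tendsto_toWeakSpace h L).norm.bddAbove_range
      exact ⟨C, fun k => hC ⟨k, rfl⟩⟩)
  refine ⟨C, fun k => ?_⟩
  rw [← (NormedSpace.inclusionInDoubleDualLi ℝ (E := E)).norm_map]
  exact hC k

/-- A function that lies in every `L^q` defines, together with a functional `A` on the values, a
continuous linear functional on `L^p`. -/
theorem exists_dual_Lp_eq_integral {α F : Type*} [MeasurableSpace α] [NormedAddCommGroup F]
    [NormedSpace ℝ F] {μ : Measure α} {p : ℝ≥0∞} [hp : Fact (1 ≤ p)] {g : α → ℝ}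
    (hg : ∀ q, MemLp g q μ) (A : StrongDual ℝ F) :
    ∃ L : StrongDual ℝ (Lp F p μ), ∀ u : Lp F p μ, L u = ∫ x, g x * A (u x) ∂μ := by
  have := ENNReal.HolderConjugate.inv_one_sub_inv' hp.out
  have : Fact (1 ≤ (1 - p⁻¹)⁻¹) := ⟨by simp⟩
  set q := (1 - p⁻¹)⁻¹
  refine ⟨(ContinuousLinearMap.lpPairing μ q p
    ((ContinuousLinearMap.lsmul ℝ ℝ).flip A)) ((hg q).toLp g), fun u => ?_⟩
  rw [ContinuousLinearMap.lpPairing_eq_integral]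
  refine integral_congr_ae ?_
  filter_upwards [(hg q).coeFn_toLp] with x hx
  rw [hx]
  simp

section W1

variable {n : ℕ} [NeZero n] {Ω : TopologicalSpace.Opens (Rn n)} {φ : ℕ → Rn n → Rn n}
  {φ₀ : Rn n → Rn n}

theorem exists_dual_W1_eq_integral {g : Rn n → ℝ}
    (hg : ∀ q, MemLp g q (volume.restrict (Ω : Set (Rn n)))) (A : StrongDual ℝ (Rn n)) :
    ∃ L : StrongDual ℝ (W1 (n : ℝ≥0∞) Ω), ∀ (ψ : Rn n → Rn n)
      (hψ : MemW1 (n : ℝ≥0∞) (Ω : Set (Rn n)) ψ), L hψ.toW1 = ∫ x in Ω, g x * A (ψ x) := by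
  obtain ⟨L, hL⟩ := exists_dual_Lp_eq_integral (p := n) hg A
  refine ⟨L.comp ((ContinuousLinearMap.fst ℝ _ _).comp (W1 (n : ℝ≥0∞) Ω).subtypeL),
    fun ψ hψ => ?_⟩
  have h1 : (L.comp ((ContinuousLinearMap.fst ℝ _ _).comp (W1 (n : ℝ≥0∞) Ω).subtypeL)) hψ.toW1 =
    L (hψ.memLp.toLp ψ) := rfl
  rw [h1, hL]
  refine integral_congr_ae ?_
  filter_upwards [hψ.memLp.coeFn_toLp] with x hx
  rw [hx]

theorem exists_dual_W1_eq_integral_weakDeriv {g : Rn n → ℝ}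
    (hg : ∀ q, MemLp g q (volume.restrict (Ω : Set (Rn n))))
    (A : StrongDual ℝ (Rn n →L[ℝ] Rn n)) :
    ∃ L : StrongDual ℝ (W1 (n : ℝ≥0∞) Ω), ∀ (ψ : Rn n → Rn n)
      (hψ : MemW1 (n : ℝ≥0∞) (Ω : Set (Rn n)) ψ),
      L hψ.toW1 = ∫ x in Ω, g x * A (weakDeriv Ω ψ x) := by
  obtain ⟨L, hL⟩ := exists_dual_Lp_eq_integral (p := n) hg A
  refine ⟨L.comp ((ContinuousLinearMap.snd ℝ _ _).comp (W1 (n : ℝ≥0∞) Ω).subtypeL),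
    fun ψ hψ => ?_⟩
  have h1 : (L.comp ((ContinuousLinearMap.snd ℝ _ _).comp (W1 (n : ℝ≥0∞) Ω).subtypeL)) hψ.toW1 =
    L (hψ.memLp_weakDeriv.toLp (weakDeriv Ω ψ)) := rfl
  rw [h1, hL]
  refine integral_congr_ae ?_
  filter_upwards [hψ.memLp_weakDeriv.coeFn_toLp] with x hx
  rw [hx]

theorem tendsto_integral_mul_of_tendsto_toW1
    (hφ : ∀ k, MemW1 (n : ℝ≥0∞) (Ω : Set (Rn n)) (φ k))
    (hφ₀ : MemW1 (n : ℝ≥0∞) (Ω : Set (Rn n)) φ₀)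
    (hweak : Tendsto (fun k => toWeakSpace ℝ (W1 (n : ℝ≥0∞) Ω) (hφ k).toW1) atTop
      (𝓝 (toWeakSpace ℝ (W1 (n : ℝ≥0∞) Ω) hφ₀.toW1)))
    {g : Rn n → ℝ} (hg : ∀ q, MemLp g q (volume.restrict (Ω : Set (Rn n))))
    (A : StrongDual ℝ (Rn n)) :
    Tendsto (fun k => ∫ x in Ω, g x * A (φ k x)) atTop
      (𝓝 (∫ x in Ω, g x * A (φ₀ x))) := by
  obtain ⟨L, hL⟩ := exists_dual_W1_eq_integral hg A
  have h := tendsto_apply_of_tendsto_toWeakSpace hweak L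
  rw [hL φ₀ hφ₀] at h
  exact h.congr fun k => hL (φ k) (hφ k)

theorem tendsto_integral_mul_weakDeriv_of_tendsto_toW1
    (hφ : ∀ k, MemW1 (n : ℝ≥0∞) (Ω : Set (Rn n)) (φ k))
    (hφ₀ : MemW1 (n : ℝ≥0∞) (Ω : Set (Rn n)) φ₀)
    (hweak : Tendsto (fun k => toWeakSpace ℝ (W1 (n : ℝ≥0∞) Ω) (hφ k).toW1) atTop
      (𝓝 (toWeakSpace ℝ (W1 (n : ℝ≥0∞) Ω) hφ₀.toW1)))
    {g : Rn n → ℝ} (hg : ∀ q, MemLp g q (volume.restrict (Ω : Set (Rn n))))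
    (A : StrongDual ℝ (Rn n →L[ℝ] Rn n)) :
    Tendsto (fun k => ∫ x in Ω, g x * A (weakDeriv Ω (φ k) x)) atTop
      (𝓝 (∫ x in Ω, g x * A (weakDeriv Ω φ₀ x))) := by
  obtain ⟨L, hL⟩ := exists_dual_W1_eq_integral_weakDeriv hg A
  have h := tendsto_apply_of_tendsto_toWeakSpace hweak L
  rw [hL φ₀ hφ₀] at h
  exact h.congr fun k => hL (φ k) (hφ k)

theorem integral_norm_pow_eq_norm_toLp {α F : Type*} [MeasurableSpace α] [NormedAddCommGroup F]
    {μ : Measure α} {f : α → F} (hf : MemLp f n μ) :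
    ∫ x, ‖f x‖ ^ n ∂μ = ‖hf.toLp f‖ ^ n := by
  rw [Lp.norm_toLp, ← ENNReal.toReal_pow, eLpNorm_natCast_pow, ← ofReal_integral_norm_pow hf,
    ENNReal.toReal_ofReal (integral_nonneg fun x => by positivity)]

theorem exists_integral_norm_pow_le_of_tendsto_toW1
    (hφ : ∀ k, MemW1 (n : ℝ≥0∞) (Ω : Set (Rn n)) (φ k))
    (hφ₀ : MemW1 (n : ℝ≥0∞) (Ω : Set (Rn n)) φ₀)
    (hweak : Tendsto (fun k => toWeakSpace ℝ (W1 (n : ℝ≥0∞) Ω) (hφ k).toW1) atTop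
      (𝓝 (toWeakSpace ℝ (W1 (n : ℝ≥0∞) Ω) hφ₀.toW1))) :
    ∃ N : ℝ, (∀ k, ∫ x in Ω, ‖φ k x‖ ^ n ≤ N) ∧ ∀ k, ∫ x in Ω, ‖weakDeriv Ω (φ k) x‖ ^ n ≤ N := by
  obtain ⟨C, hC⟩ := exists_norm_le_of_tendsto_toWeakSpace hweak
  refine ⟨C ^ n, fun k => ?_, fun k => ?_⟩
  · rw [integral_norm_pow_eq_norm_toLp (hφ k).memLp]
    exact pow_le_pow_left₀ (norm_nonneg _) ((le_max_left _ _).trans (hC k)) n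
  · rw [integral_norm_pow_eq_norm_toLp (hφ k).memLp_weakDeriv]
    exact pow_le_pow_left₀ (norm_nonneg _) ((le_max_right _ _).trans (hC k)) n

/-- Weak continuity of the Jacobian: weak convergence in `W^1_n` implies convergence of the
Jacobians in the sense of distributions. -/
theorem tendsto_integral_mul_jacobian
    (hφ : ∀ k, MemW1 (n : ℝ≥0∞) (Ω : Set (Rn n)) (φ k))
    (hφ₀ : MemW1 (n : ℝ≥0∞) (Ω : Set (Rn n)) φ₀)
    (hweak : Tendsto (fun k => toWeakSpace ℝ (W1 (n : ℝ≥0∞) Ω) (hφ k).toW1) atTop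
      (𝓝 (toWeakSpace ℝ (W1 (n : ℝ≥0∞) Ω) hφ₀.toW1)))
    {θ : Rn n → ℝ} (hθ : ContDiff ℝ ∞ θ) (hθc : HasCompactSupport θ)
    (hθΩ : tsupport θ ⊆ (Ω : Set (Rn n))) :
    Tendsto (fun k => ∫ x in Ω, θ x * jacobian Ω (φ k) x) atTop
      (𝓝 (∫ x in Ω, θ x * jacobian Ω φ₀ x)) := by
  obtain ⟨N, hN1, hN2⟩ := exists_integral_norm_pow_le_of_tendsto_toW1 hφ hφ₀ hweak
  refine tendsto_integral_mul_det Ω.isOpen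
    (fun k => isWeakDeriv_weakDeriv (hφ k).exists_weakDeriv)
    (isWeakDeriv_weakDeriv hφ₀.exists_weakDeriv) (fun k => (hφ k).memLp) hφ₀.memLp
    (fun k => (hφ k).memLp_weakDeriv) hφ₀.memLp_weakDeriv hN1 hN2 ?_ hθ hθc hθΩ
  intro g hg hgc hgΩ
  have hint : ∀ {ψ : Rn n → Rn n}, MemW1 (n : ℝ≥0∞) (Ω : Set (Rn n)) ψ → ∀ i : Fin n,
      (∫ x in Ω, g x • ψ x) i = ∫ x in Ω, g x * EuclideanSpace.proj (𝕜 := ℝ) i (ψ x) := by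
    intro ψ hψ i
    have h1 := integrableOn_smul_of_test hg hgc hgΩ
      (isWeakDeriv_weakDeriv hψ.exists_weakDeriv).locInt
    have h2 := (EuclideanSpace.proj (𝕜 := ℝ) i).integral_comp_comm h1
    simp only [map_smul, smul_eq_mul] at h2
    exact h2.symm
  have h3 : Tendsto (fun k => (fun i => (∫ x in Ω, g x • φ k x) i)) atTop
      (𝓝 (fun i => (∫ x in Ω, g x • φ₀ x) i)) := by
    refine tendsto_pi_nhds.2 fun i => ?_
    rw [hint hφ₀]
    simp_rw [fun k => hint (hφ k)]
    exact tendsto_integral_mul_of_tendsto_toW1 hφ hφ₀ hweak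
      (fun q => (hg.memLp_of_hasCompactSupport hgc).restrict _) _
  exact ((PiLp.continuous_toLp 2 _).tendsto _).comp h3

end W1

/-! ### Pointwise inequalities from test functions -/

/-- A locally integrable function with nonnegative integrals against nonnegative test functions is
nonnegative almost everywhere. -/
theorem ae_nonneg_of_forall_integral_mul_nonneg {n : ℕ} {Ω : Set (Rn n)} (hΩ : IsOpen Ω)
    {w : Rn n → ℝ} (hw : LocallyIntegrableOn w Ω)
    (h : ∀ θ : Rn n → ℝ, ContDiff ℝ ∞ θ → HasCompactSupport θ → tsupport θ ⊆ Ω → (∀ x, 0 ≤ θ x) →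
      0 ≤ ∫ x in Ω, θ x * w x) : ∀ᵐ x ∂volume.restrict Ω, 0 ≤ w x := by
  obtain ⟨σ, hσ, hσ2⟩ := exists_contDiffBump_seq n
  rw [ae_restrict_iff' hΩ.measurableSet, ae_iff]
  refine measure_null_of_locally_null _ fun x hx => ?_
  simp only [Set.mem_ofPred_eq, Classical.not_imp] at hx
  -- near `x`, `w` is the a.e. limit of mollifications of `χ w`, which are integrals of `w`
  -- against nonnegative test functions
  obtain ⟨χ, hχ, hχc, hχΩ, hχ0, hχ1⟩ := exists_contDiff_cutoff isCompact_singleton hΩ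
    (Set.singleton_subset_iff.2 hx.1)
  have hoff : ∀ y ∉ Ω, χ y = 0 := fun y hy =>
    image_eq_zero_of_notMem_tsupport fun h => hy (hχΩ h)
  have hint : Integrable fun y => χ y * w y :=
    memLp_one_iff_integrable.1 (memLp_of_memLp_restrict hΩ.measurableSet
      (memLp_one_iff_integrable.2 (integrableOn_smul_of_test hχ.continuous hχc hχΩ hw))
      fun y hy => by simp [hoff y hy])
  have hae := ContDiffBump.ae_convolution_tendsto_right_of_locallyIntegrable (K := 2) hσ
    (Eventually.of_forall fun m => (hσ2 m).le) hint.locallyIntegrable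
  refine ⟨_, ?_, ae_iff.1 hae⟩
  filter_upwards [self_mem_nhdsWithin, mem_nhdsWithin_of_mem_nhds (hχ1 x rfl)] with y hy hy1
  simp only [Classical.not_imp] at hy ⊢
  intro ht
  have hy1' : χ y = 1 := hy1
  rw [hy1', one_mul] at ht
  refine hy.2 (ge_of_tendsto' ht fun m => ?_)
  rw [convolution_eq_swap, ← setIntegral_eq_integral_of_forall_compl_eq_zero (s := Ω)
    (fun z hz => by simp [hoff z hz])]
  have hρ : ContDiff ℝ ∞ ((σ m).normed (volume : Measure (Rn n))) := (σ m).contDiff_normed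
  have := h (fun z => (σ m).normed volume (y - z) * χ z)
    ((hρ.comp (contDiff_const.sub contDiff_id)).mul hχ) hχc.mul_left
    (tsupport_mul_subset_right.trans hχΩ)
    (fun z => mul_nonneg ((σ m).nonneg_normed _) (hχ0 z))
  simpa [mul_assoc] using this

/-- The distortion function is at most `m ^ (1 / n)` if and only if the distortion inequality holds
with the constant `m`, also at the zeros of the Jacobian. -/
theorem ofReal_div_ofReal_le_iff {n : ℕ} (hn : n ≠ 0) {d J m : ℝ} (hd : 0 ≤ d) (hJ : 0 ≤ J)
    (hm : 0 ≤ m) : ENNReal.ofReal d / ENNReal.ofReal (|J| ^ (1 / (n : ℝ))) ≤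
      ENNReal.ofReal (m ^ (1 / (n : ℝ))) ↔ d ^ n ≤ m * J := by
  have hn' : (0 : ℝ) < n := by positivity
  rw [abs_of_nonneg hJ]
  rcases hJ.eq_or_lt with rfl | hJ
  · rw [Real.zero_rpow (by positivity), ENNReal.ofReal_zero, mul_zero]
    rcases hd.eq_or_lt with rfl | hd
    · simp [hn]
    · rw [ENNReal.div_zero (by simpa using hd)]
      simp only [top_le_iff, ENNReal.ofReal_ne_top, false_iff, not_le]
      positivity
  · have hJ' : 0 < J ^ (1 / (n : ℝ)) := Real.rpow_pos_of_pos hJ _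
    rw [ENNReal.div_le_iff (by simpa using hJ') (by simp), ← ENNReal.ofReal_mul (by positivity),
      ← Real.mul_rpow hm hJ.le, ENNReal.ofReal_le_ofReal_iff (by positivity), one_div,
      Real.le_rpow_inv_iff_of_pos hd (by positivity) hn', Real.rpow_natCast]

/-- The tangent line inequality for the convex function `y ↦ y ^ n` at `a`. -/
theorem natCast_mul_pow_mul_le {n : ℕ} (hn : n ≠ 0) {a y : ℝ} (ha : 0 ≤ a) (hy : 0 ≤ y) :
    n * a ^ (n - 1) * y ≤ y ^ n + (n - 1) * a ^ n := by
  obtain ⟨m, rfl⟩ := Nat.exists_eq_succ_of_ne_zero hn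
  simp only [Nat.succ_eq_add_one, Nat.add_sub_cancel, Nat.cast_add, Nat.cast_one,
    add_sub_cancel_right]
  induction m with
  | zero => simp
  | succ m ih =>
    have ih := ih (by simp)
    have h1 : 0 ≤ (y - a) * (y ^ (m + 1) - a ^ (m + 1)) := by
      rcases le_total a y with h | h
      · exact mul_nonneg (sub_nonneg.2 h) (sub_nonneg.2 (by gcongr))
      · exact mul_nonneg_of_nonpos_of_nonpos (sub_nonpos.2 h) (sub_nonpos.2 (by gcongr))
    have h2 := mul_le_mul_of_nonneg_left ih ha
    push_cast
    ring_nf at h1 h2 ⊢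
    linarith

/-- The inequality `‖D‖ ^ n ≤ b` follows from a countable family of inequalities that are affine in
`D` and `b`. -/
theorem norm_pow_le_of_forall_dual {n : ℕ} (hn : n ≠ 0) {E : Type*} [NormedAddCommGroup E]
    [NormedSpace ℝ E] [Nontrivial E] {S : Set (StrongDual ℝ E)} (hS : Dense S) {D : E} {b : ℝ}
    (h : ∀ A ∈ S, ∀ a : ℚ, n * |(a : ℝ)| ^ (n - 1) * A D ≤ ‖A‖ * (b + (n - 1) * |(a : ℝ)| ^ n)) :
    ‖D‖ ^ n ≤ b := by
  -- by density, `A` may be a norming functional of `D`, and `a` may be `‖D‖`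
  obtain ⟨A, hA, hAD⟩ := exists_dual_vector' ℝ D
  have h1 : ∀ a : ℚ, n * |(a : ℝ)| ^ (n - 1) * A D ≤ ‖A‖ * (b + (n - 1) * |(a : ℝ)| ^ n) := by
    intro a
    have hcl : IsClosed {A : StrongDual ℝ E | n * |(a : ℝ)| ^ (n - 1) * A D ≤
        ‖A‖ * (b + (n - 1) * |(a : ℝ)| ^ n)} :=
      isClosed_le (by fun_prop) (by fun_prop)
    exact closure_minimal (fun A hA => h A hA a) hcl (hS A)
  have h2 : ∀ a : ℝ, n * |a| ^ (n - 1) * A D ≤ ‖A‖ * (b + (n - 1) * |a| ^ n) := by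
    have hcl : IsClosed {a : ℝ | n * |a| ^ (n - 1) * A D ≤ ‖A‖ * (b + (n - 1) * |a| ^ n)} :=
      isClosed_le (by fun_prop) (by fun_prop)
    intro a
    exact closure_minimal (by rintro _ ⟨q, rfl⟩; exact h1 q) hcl (Rat.denseRange_cast a)
  have h3 := h2 ‖D‖
  rw [hA, hAD, one_mul, RCLike.ofReal_real_eq_id, id_eq, abs_of_nonneg (norm_nonneg _), mul_assoc,
    pow_sub_one_mul hn] at h3
  linarith

theorem le_mul_of_forall_rat_lt {y m J : ℝ} (h : ∀ q : ℚ, m < q → y ≤ q * J) :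
    y ≤ m * J := by
  obtain ⟨q₀, hq₀⟩ := exists_rat_gt m
  have hcl : m ∈ closure {r : ℝ | y ≤ r * J} := by
    rw [mem_closure_iff_seq_limit]
    obtain ⟨u, -, hu, hu2⟩ := exists_seq_strictAnti_tendsto m
    choose q hq using fun k => exists_rat_btwn (hu k)
    exact ⟨fun k => q k, fun k => h _ (hq k).1, tendsto_of_tendsto_of_tendsto_of_le_of_le
      tendsto_const_nhds hu2 (fun k => (hq k).1.le) fun k => (hq k).2.le⟩
  exact closure_minimal (fun r hr => hr)
    (isClosed_le continuous_const (continuous_id.mul continuous_const)) hcl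

/-! ### Limits of mappings with finite distortion -/

/-- The distortion inequality with a constant `q` on a measurable set `E`, linearized at the
parameters `a` and `A`, passes to the limit: it is an inequality between the quantities that
converge when tested with functions. Off `E`, only `0 ≤ det D` is used. -/
theorem ae_linearized_distortion_le_of_tendsto {n : ℕ} [NeZero n] {Ω : Set (Rn n)}
    (hΩ : IsOpen Ω) {D : ℕ → Rn n → (Rn n →L[ℝ] Rn n)} {D₀ : Rn n → (Rn n →L[ℝ] Rn n)}
    (hD : ∀ k, MemLp (D k) n (volume.restrict Ω)) (hD₀ : MemLp D₀ n (volume.restrict Ω))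
    (hconv : ∀ θ : Rn n → ℝ, ContDiff ℝ ∞ θ → HasCompactSupport θ → tsupport θ ⊆ Ω →
      Tendsto (fun k => ∫ x in Ω, θ x * (D k x).det) atTop (𝓝 (∫ x in Ω, θ x * (D₀ x).det)))
    (A : StrongDual ℝ (Rn n →L[ℝ] Rn n))
    (hconvA : ∀ g : Rn n → ℝ, (∀ p, MemLp g p (volume.restrict Ω)) →
      Tendsto (fun k => ∫ x in Ω, g x * A (D k x)) atTop (𝓝 (∫ x in Ω, g x * A (D₀ x))))
    {E : Set (Rn n)} (hE : MeasurableSet E) {q : ℝ} (hq : 0 ≤ q)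
    (hJ : ∀ k, ∀ᵐ x ∂volume.restrict Ω, 0 ≤ (D k x).det)
    (hEq : ∀ k, ∀ᵐ x ∂volume.restrict Ω, x ∈ E → ‖D k x‖ ^ n ≤ q * (D k x).det)
    {a : ℝ} (ha : 0 ≤ a) :
    ∀ᵐ x ∂volume.restrict Ω, x ∈ E →
      n * a ^ (n - 1) * A (D₀ x) ≤ ‖A‖ * (q * (D₀ x).det + (n - 1) * a ^ n) := by
  have hn := NeZero.ne n
  have hn1 : (0 : ℝ) ≤ n - 1 := sub_nonneg.2 (by exact_mod_cast NeZero.one_le)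
  have hone : (1 : ℝ≥0∞) ≤ n := by exact_mod_cast NeZero.one_le
  set W : (Rn n → (Rn n →L[ℝ] Rn n)) → Rn n → ℝ := fun ψ x =>
    ‖A‖ * (q * (ψ x).det + (n - 1) * a ^ n) -
      n * a ^ (n - 1) * E.indicator (fun x => A (ψ x)) x with hW
  have iJ : ∀ {ψ : Rn n → (Rn n →L[ℝ] Rn n)}, MemLp ψ n (volume.restrict Ω) →
      Integrable (fun x => (ψ x).det) (volume.restrict Ω) := fun hψ =>
    integrable_det_of_memLp hψ
  have jA : ∀ {ψ : Rn n → (Rn n →L[ℝ] Rn n)}, MemLp ψ n (volume.restrict Ω) →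
      MemLp (E.indicator fun x => A (ψ x)) n (volume.restrict Ω) :=
    fun hψ => (A.comp_memLp' hψ).indicator hE
  have hloc : ∀ {ψ}, MemLp ψ n (volume.restrict Ω) → LocallyIntegrableOn (W ψ) Ω := by
    intro ψ hψ
    have l1 : LocallyIntegrableOn (fun x => (ψ x).det) Ω :=
      IntegrableOn.locallyIntegrableOn (iJ hψ)
    have l2 : LocallyIntegrableOn (E.indicator fun x => A (ψ x)) Ω :=
      locallyIntegrableOn_of_locallyIntegrable_restrict ((jA hψ).locallyIntegrable hone)
    exact (((l1.smul q).add (locallyIntegrableOn_const _)).smul ‖A‖).sub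
      (l2.smul (n * a ^ (n - 1)))
  suffices h : ∀ᵐ x ∂volume.restrict Ω, 0 ≤ W D₀ x by
    filter_upwards [h] with x hx hxE
    simpa [hW, hxE] using hx
  refine ae_nonneg_of_forall_integral_mul_nonneg hΩ (hloc hD₀) fun θ hθ hθc hθΩ hθ0 => ?_
  have hnonneg : ∀ k, 0 ≤ ∫ x in Ω, θ x * W (D k) x := by
    intro k
    refine integral_nonneg_of_ae ?_
    filter_upwards [hJ k, hEq k] with x hx1 hx2
    refine mul_nonneg (hθ0 x) ?_
    by_cases hxE : x ∈ E
    · simp only [hW, Set.indicator_of_mem hxE]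
      have h1 : A (D k x) ≤ ‖A‖ * ‖D k x‖ :=
        (le_abs_self _).trans (A.le_opNorm _)
      have h2 := natCast_mul_pow_mul_le hn ha (norm_nonneg (D k x))
      have h3 := hx2 hxE
      have h4 : n * a ^ (n - 1) * A (D k x) ≤
          n * a ^ (n - 1) * (‖A‖ * ‖D k x‖) := by gcongr
      have h5 : ‖A‖ * (n * a ^ (n - 1) * ‖D k x‖) ≤
          ‖A‖ * (q * (D k x).det + (n - 1) * a ^ n) := by
        gcongr
        linarith
      linarith
    · simp only [hW, Set.indicator_of_notMem hxE, mul_zero, sub_zero]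
      positivity
  have hsplit : ∀ {ψ}, MemLp ψ n (volume.restrict Ω) → ∫ x in Ω, θ x * W ψ x =
      ‖A‖ * q * (∫ x in Ω, θ x * (ψ x).det) + ‖A‖ * ((n - 1) * a ^ n) * (∫ x in Ω, θ x) -
        n * a ^ (n - 1) * ∫ x in Ω, E.indicator θ x * A (ψ x) := by
    intro ψ hψ
    obtain ⟨B, hB⟩ := hθc.exists_bound_of_continuous hθ.continuous
    have i1 : Integrable (fun x => θ x * (ψ x).det) (volume.restrict Ω) :=
      (iJ hψ).bdd_mul hθ.continuous.aestronglyMeasurable (Eventually.of_forall hB)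
    have i2 : Integrable θ (volume.restrict Ω) :=
      (hθ.continuous.integrable_of_hasCompactSupport hθc).restrict
    have i3 : Integrable (fun x => E.indicator θ x * A (ψ x))
        (volume.restrict Ω) := by
      have h1 : (fun x => E.indicator θ x * A (ψ x)) =
          fun x => θ x • E.indicator (fun x => A (ψ x)) x := by
        funext x
        by_cases hx : x ∈ E <;> simp [hx]
      rw [h1]
      exact integrableOn_smul_of_test hθ.continuous hθc hθΩ
        (locallyIntegrableOn_of_locallyIntegrable_restrict ((jA hψ).locallyIntegrable hone))
    have i12 : Integrable (fun x => ‖A‖ * q * (θ x * (ψ x).det) +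
        ‖A‖ * ((n - 1) * a ^ n) * θ x) (volume.restrict Ω) :=
      (i1.const_mul _).add (i2.const_mul _)
    rw [← integral_const_mul, ← integral_const_mul, ← integral_const_mul,
      ← integral_add (i1.const_mul _) (i2.const_mul _), ← integral_sub i12 (i3.const_mul _)]
    refine integral_congr_ae (Eventually.of_forall fun x => ?_)
    by_cases hx : x ∈ E <;> simp only [hW, hx, Set.indicator_of_mem, Set.indicator_of_notMem,
      not_false_eq_true] <;> ring
  rw [hsplit hD₀]
  have hlim := (((hconv θ hθ hθc hθΩ).const_mul (‖A‖ * q)).add_const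
    (‖A‖ * ((n - 1) * a ^ n) * (∫ x in Ω, θ x))).sub ((hconvA (E.indicator θ) fun p =>
      ((hθ.continuous.memLp_of_hasCompactSupport hθc).restrict _).indicator hE).const_mul
        (n * a ^ (n - 1)))
  exact ge_of_tendsto' hlim fun k => (hsplit (hD k)).symm ▸ hnonneg k

/-- The distortion inequality `|D|^n ≤ M det D` is stable under weak convergence of `D` and
convergence of `det D` in the sense of distributions. -/
theorem ae_norm_pow_le_mul_det_of_tendsto {n : ℕ} [NeZero n] {Ω : Set (Rn n)}
    (hΩ : IsOpen Ω) {D : ℕ → Rn n → (Rn n →L[ℝ] Rn n)} {D₀ : Rn n → (Rn n →L[ℝ] Rn n)}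
    (hD : ∀ k, MemLp (D k) n (volume.restrict Ω)) (hD₀ : MemLp D₀ n (volume.restrict Ω))
    (hconv : ∀ θ : Rn n → ℝ, ContDiff ℝ ∞ θ → HasCompactSupport θ → tsupport θ ⊆ Ω →
      Tendsto (fun k => ∫ x in Ω, θ x * (D k x).det) atTop (𝓝 (∫ x in Ω, θ x * (D₀ x).det)))
    (hconvA : ∀ (A : StrongDual ℝ (Rn n →L[ℝ] Rn n)) (g : Rn n → ℝ),
      (∀ p, MemLp g p (volume.restrict Ω)) →
      Tendsto (fun k => ∫ x in Ω, g x * A (D k x)) atTop (𝓝 (∫ x in Ω, g x * A (D₀ x))))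
    {M : Rn n → ℝ} (hM : AEStronglyMeasurable M (volume.restrict Ω))
    (hM_nonneg : ∀ᵐ x ∂volume.restrict Ω, 0 ≤ M x)
    (hJ : ∀ k, ∀ᵐ x ∂volume.restrict Ω, 0 ≤ (D k x).det)
    (hle : ∀ k, ∀ᵐ x ∂volume.restrict Ω, ‖D k x‖ ^ n ≤ M x * (D k x).det) :
    ∀ᵐ x ∂volume.restrict Ω, 0 ≤ (D₀ x).det ∧ ‖D₀ x‖ ^ n ≤ M x * (D₀ x).det := by
  have hn := NeZero.ne n
  have : Nontrivial (Rn n) := by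
    have : Nonempty (Fin n) := ⟨0⟩
    infer_instance
  have hS := TopologicalSpace.denseRange_denseSeq (StrongDual ℝ (Rn n →L[ℝ] Rn n))
  -- the sets `{M ≤ q}`, up to null sets
  set E : ℚ → Set (Rn n) := fun q => {x | hM.mk M x ≤ q} with hE
  have hEm : ∀ q, MeasurableSet (E q) := fun q =>
    measurableSet_le hM.stronglyMeasurable_mk.measurable measurable_const
  have key : ∀ q : ℚ, ∀ i : ℕ, ∀ a : ℚ, 0 ≤ (q : ℝ) →
      ∀ᵐ x ∂volume.restrict Ω, x ∈ E q →
      n * |(a : ℝ)| ^ (n - 1) *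
          TopologicalSpace.denseSeq (StrongDual ℝ (Rn n →L[ℝ] Rn n)) i (D₀ x) ≤
        ‖TopologicalSpace.denseSeq (StrongDual ℝ (Rn n →L[ℝ] Rn n)) i‖ *
          (q * (D₀ x).det + (n - 1) * |(a : ℝ)| ^ n) := by
    intro q i a hq
    refine ae_linearized_distortion_le_of_tendsto hΩ hD hD₀ hconv _ (hconvA _) (hEm q) hq hJ
      (fun k => ?_) (abs_nonneg _)
    filter_upwards [hJ k, hle k, hM.ae_eq_mk] with x h1 h2 h3 hx
    refine h2.trans (mul_le_mul_of_nonneg_right ?_ h1)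
    rw [h3]
    exact hx
  have key' : ∀ᵐ x ∂volume.restrict Ω, ∀ q : ℚ, ∀ i : ℕ, ∀ a : ℚ, 0 ≤ (q : ℝ) →
      x ∈ E q → n * |(a : ℝ)| ^ (n - 1) *
          TopologicalSpace.denseSeq (StrongDual ℝ (Rn n →L[ℝ] Rn n)) i (D₀ x) ≤
        ‖TopologicalSpace.denseSeq (StrongDual ℝ (Rn n →L[ℝ] Rn n)) i‖ *
          (q * (D₀ x).det + (n - 1) * |(a : ℝ)| ^ n) := by
    simp only [ae_all_iff]
    exact key
  filter_upwards [key', hM.ae_eq_mk, hM_nonneg] with x hx hMx hM0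
  have hq : ∀ q : ℚ, M x < q → ‖D₀ x‖ ^ n ≤ q * (D₀ x).det := by
    intro q hq
    refine norm_pow_le_of_forall_dual hn hS ?_
    rintro _ ⟨i, rfl⟩ a
    refine hx q i a (hM0.trans hq.le) ?_
    simp only [hE, Set.mem_ofPred_eq]
    rw [← hMx]
    exact hq.le
  refine ⟨?_, le_mul_of_forall_rat_lt hq⟩
  obtain ⟨q, hq'⟩ := exists_rat_gt (M x)
  have h1 : 0 ≤ q * (D₀ x).det := (pow_nonneg (norm_nonneg _) n).trans (hq q hq')
  exact nonneg_of_mul_nonneg_right h1 (hM0.trans_lt hq')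

theorem mainTheorem4 (n : ℕ) [NeZero n] (Ω : TopologicalSpace.Opens (Rn n))
    (φ : ℕ → Rn n → Rn n) (φ₀ : Rn n → Rn n)
    (hφ : ∀ k, MemW1 (n : ℝ≥0∞) (Ω : Set (Rn n)) (φ k))
    (hφ₀ : MemW1 (n : ℝ≥0∞) (Ω : Set (Rn n)) φ₀)
    (hweak : Tendsto (fun k => toWeakSpace ℝ (W1 (n : ℝ≥0∞) Ω) (hφ k).toW1) atTop
      (𝓝 (toWeakSpace ℝ (W1 (n : ℝ≥0∞) Ω) hφ₀.toW1)))
    (hFD : ∀ k, FiniteDistortion (Ω : Set (Rn n)) (φ k))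
    (s : ℝ) (hs : 0 < s) (M : Rn n → ℝ)
    (hM : MemLp M (ENNReal.ofReal s) (volume.restrict (Ω : Set (Rn n))))
    (hM_nonneg : ∀ᵐ x ∂volume.restrict (Ω : Set (Rn n)), 0 ≤ M x)
    (hK : ∀ k, ∀ᵐ x ∂volume.restrict (Ω : Set (Rn n)),
      distortionFn (n : ℝ) (Ω : Set (Rn n)) (φ k) x ≤ ENNReal.ofReal (M x ^ (1 / (n : ℝ)))) :
    FiniteDistortion (Ω : Set (Rn n)) φ₀ ∧
    (∀ᵐ x ∂volume.restrict (Ω : Set (Rn n)),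
      distortionFn (n : ℝ) (Ω : Set (Rn n)) φ₀ x ≤ ENNReal.ofReal (M x ^ (1 / (n : ℝ)))) ∧
    (∀ᵐ x ∂volume.restrict (Ω : Set (Rn n)),
      ‖weakDeriv (Ω : Set (Rn n)) φ₀ x‖ ^ n ≤ M x * jacobian (Ω : Set (Rn n)) φ₀ x) := by
  have hn := NeZero.ne n
  have hle : ∀ k, ∀ᵐ x ∂volume.restrict (Ω : Set (Rn n)),
      ‖weakDeriv Ω (φ k) x‖ ^ n ≤ M x * jacobian Ω (φ k) x := by
    intro k
    filter_upwards [hK k, hM_nonneg, (hFD k).jacobian_nonneg] with x h1 h2 h3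
    exact (ofReal_div_ofReal_le_iff hn (norm_nonneg _) h3 h2).1 h1
  have hmain : ∀ᵐ x ∂volume.restrict (Ω : Set (Rn n)), 0 ≤ jacobian Ω φ₀ x ∧
      ‖weakDeriv Ω φ₀ x‖ ^ n ≤ M x * jacobian Ω φ₀ x :=
    ae_norm_pow_le_mul_det_of_tendsto Ω.isOpen (fun k => (hφ k).memLp_weakDeriv)
      hφ₀.memLp_weakDeriv (fun θ => tendsto_integral_mul_jacobian hφ hφ₀ hweak)
      (fun A g hg => tendsto_integral_mul_weakDeriv_of_tendsto_toW1 hφ hφ₀ hweak hg A) hM.1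
      hM_nonneg
      (fun k => (hFD k).jacobian_nonneg) hle
  refine ⟨⟨hφ₀.exists_weakDeriv, hmain.mono fun x hx => hx.1, fun x => M x + 1, ?_⟩, ?_,
    hmain.mono fun x hx => hx.2⟩
  · filter_upwards [hmain, hM_nonneg] with x hx h0
    -- `M` may vanish, whereas the distortion coefficient has to be positive
    exact ⟨by linarith, by linarith [hx.1, hx.2]⟩
  · filter_upwards [hmain, hM_nonneg] with x hx h0
    exact (ofReal_div_ofReal_le_iff hn (norm_nonneg _) hx.1 h0).2 hx.2

end
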